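/- Let $Z$ be a set of consecutive integers (possibly infinite) and, for each $r\in Z$, let $V_r$ be a complex vector space of dimension $k$. Let $A_r,B_r,D_r\in\mathrm{End}(V_r)$ for $r\in Z$ and $P^+_r:V_r\to V_{r+1}$, $P^-_{r+1}:V_{r+1}\to V_r$ for $r,r+1\in Z$ be linear maps that solve the discrete Nahm equations on $Z$: for all $r,r+1\in Z$, $$P^-_{r+1}A_{r+1}=A_rP^-_{r+1},\quad P^+_rD_r=D_{r+1}P^+_r,\quad B_r=P^-_{r+1}P^+_r+A_rD_r,\quad B_{r+1}=P^+_rP^-_{r+1}+D_{r+1}A_{r+1}.$$ Put $M_r(\eta,\zeta)=\eta\zeta A_r+\eta B_r+\zeta+D_r$, with homogeneous form $w_0z_0A_r+w_0z_1B_r+w_1z_0+w_1z_1D_r$ in the coordinates $\eta=w_0/w_1$, $\zeta=z_0/z_1$ on $\mathbb P_1\times\mathbb P_1$. Let $S_r=\{\det M_r=0\}\subset\mathbb P_1\times\mathbb P_1$ be the spectral curve, and call it smooth if the divisor of $\det M_r$ is smooth. Let $\mathcal L_r$ be the cokernel of $M_r:V_r\otimes\mathcal O(-1,-1)\to V_r\otimes\mathcal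 O$. (1) If all the maps $P^+_r$ and $P^-_{r+1}$ ($r,r+1\in Z$) are invertible, then $S_r=S_{r'}$ for all $r,r'\in Z$; indeed $\det M_r=\det M_{r'}$. (2) If $S_{r_0}$ is smooth for some $r_0\in Z$, then, without assuming the maps $P^\pm$ invertible, $\det M_r=\det M_{r'}$ for all $r,r'\in Z$, so that all the $S_r$ are one and the same smooth curve $S$; each $\mathcal L_r$ is a holomorphic line bundle on $S$; and, with $L=\mathcal O(1,-1)|_S$, $$\mathcal L_{r'}\cong\mathcal L_r\otimes L^{\,r'-r}\qquad\text{for all } r,r'\in Z.$$ Thus the evolution is straight-line motion, in steps of the fixed size $L$, in the group of isomorphism classes of holomorphic line bundles on $S$. -/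

import Mathlib

open Filter Topology
open scoped TensorProduct LinearAlgebra.Projectivization

universe u v

namespace DiscreteNahm

/-! ### The surface `Q = ℙ₁ × ℙ₁` -/

/-- The complex projective line, with homogeneous coordinates indexed by `Fin 2`. -/
abbrev P1 : Type := ℙ ℂ (Fin 2 → ℂ)

/-- The quotient topology of `ℂ² ∖ {0}`. -/
instance P1.topology : TopologicalSpace P1 :=
  inferInstanceAs (TopologicalSpace (Quotient (projectivizationSetoid ℂ (Fin 2 → ℂ))))

/-- `ℙ₁ × ℙ₁`, with homogeneous coordinates `[w₀, w₁]` and `[z₀, z₁]` on the factors. -/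
abbrev Q : Type := P1 × P1

/-- The space `ℂ² × ℂ²` of pairs `(w, z)` of homogeneous coordinate vectors. -/
abbrev C2C2 : Type := (Fin 2 → ℂ) × (Fin 2 → ℂ)

/-- `(w, z)` is a pair of homogeneous coordinate vectors of the point `p`. -/
def IsLift (u : C2C2) (p : Q) : Prop :=
  ∃ (h₁ : u.1 ≠ 0) (h₂ : u.2 ≠ 0), Projectivization.mk ℂ u.1 h₁ = p.1 ∧
    Projectivization.mk ℂ u.2 h₂ = p.2

/-- The pairs of homogeneous coordinate vectors of the point `p`. -/
abbrev Lift (p : Q) : Type := {u : C2C2 // IsLift u p}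

/-! ### Holomorphic functions and holomorphic line bundles on a curve in `Q`

Local sections near a point are represented by globally defined, otherwise arbitrary, sections
that are holomorphic near that point. -/

/-- The function `f` on `S ⊆ Q` is holomorphic near `p`: written in homogeneous coordinates, it
is locally the restriction of a holomorphic function of `(w, z)`. -/
def HolAt {S : Set Q} (f : S → ℂ) (p : S) : Prop :=
  ∀ u₀ : Lift p.1, ∃ F : C2C2 → ℂ, AnalyticAt ℂ F u₀.1 ∧
    ∀ᶠ u in 𝓝 u₀.1, ∀ q : S, IsLift u q.1 → f q = F u

/-- A family of complex vector spaces over the points of `S ⊆ Q`, together with the notion of a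
section being holomorphic near a point. -/
structure PreBundle (S : Set Q) : Type (u + 1) where
  /-- The fibre at a point. -/
  fiber : S → Type u
  [instAddCommGroup : ∀ p, AddCommGroup (fiber p)]
  [instModule : ∀ p, Module ℂ (fiber p)]
  /-- The section `s` is holomorphic near `p`. -/
  IsHolAt : (∀ p, fiber p) → S → Prop

attribute [instance] PreBundle.instAddCommGroup PreBundle.instModule

namespace PreBundle

variable {S : Set Q}

/-- A holomorphic line bundle on `S`: the fibres are lines, and near every point there is a
nowhere vanishing section `e` such that the holomorphic sections are exactly the multiples of `e`
by holomorphic functions. -/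
def IsHolomorphicLineBundle (E : PreBundle.{u} S) : Prop :=
  (∀ p, Module.finrank ℂ (E.fiber p) = 1) ∧
  ∀ p : S, ∃ e : ∀ q, E.fiber q, ∀ᶠ q in 𝓝 p, e q ≠ 0 ∧
    ∀ s : ∀ q, E.fiber q, E.IsHolAt s q ↔
      ∃ f : S → ℂ, HolAt f q ∧ ∀ᶠ x in 𝓝 q, s x = f x • e x

/-- `E` and `F` are isomorphic: there are linear isomorphisms of the fibres that carry the
holomorphic sections of `E` exactly to those of `F`. -/
def IsIsomorphic (E : PreBundle.{u} S) (F : PreBundle.{v} S) : Prop :=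
  ∃ φ : ∀ p, E.fiber p ≃ₗ[ℂ] F.fiber p, ∀ (s : ∀ p, E.fiber p) (p : S),
    F.IsHolAt (fun q => φ q (s q)) p ↔ E.IsHolAt s p

/-- The trivial line bundle. -/
def trivial (S : Set Q) : PreBundle.{0} S where
  fiber _ := ℂ
  IsHolAt := HolAt

/-- The tensor product: its holomorphic sections are locally the finite sums of tensor products
of holomorphic sections. -/
noncomputable def tensor (E : PreBundle.{u} S) (F : PreBundle.{v} S) :
    PreBundle.{max u v} S where
  fiber p := E.fiber p ⊗[ℂ] F.fiber p
  IsHolAt s p := ∃ (n : ℕ) (a : Fin n → ∀ q, E.fiber q) (b : Fin n → ∀ q, F.fiber q),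
    (∀ i, E.IsHolAt (a i) p) ∧ (∀ i, F.IsHolAt (b i) p) ∧
    ∀ᶠ q in 𝓝 p, s q = ∑ i, a i q ⊗ₜ[ℂ] b i q

/-- The dual bundle: its holomorphic sections are those whose pairing with every holomorphic
section is holomorphic. -/
def dual (E : PreBundle.{u} S) : PreBundle.{u} S where
  fiber p := Module.Dual ℂ (E.fiber p)
  IsHolAt s p := ∀ a : ∀ q, E.fiber q, E.IsHolAt a p → HolAt (fun q => s q (a q)) p

/-- The tensor power `Eⁿ` for a natural number `n`. -/
noncomputable def npow (E : PreBundle.{0} S) : ℕ → PreBundle.{0} S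
  | 0 => trivial S
  | n + 1 => (npow E n).tensor E

/-- The tensor power `Eⁿ` of a line bundle for an integer `n`; the negative powers are the powers
of the dual. -/
noncomputable def zpow (E : PreBundle.{0} S) : ℤ → PreBundle.{0} S
  | Int.ofNat n => E.npow n
  | Int.negSucc n => E.dual.npow (n + 1)

/-- The fibre of `𝒪(a, b)` at `p`: the functions of the homogeneous coordinates of `p` that are
homogeneous of degree `a` in `w` and of degree `b` in `z`. -/
def twistFiber (a b : ℤ) (p : Q) : Submodule ℂ (Lift p → ℂ) where
  carrier := {h | ∀ (u u' : Lift p) (c d : ℂ), u'.1.1 = c • u.1.1 → u'.1.2 = d • u.1.2 →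
    h u' = c ^ a * d ^ b * h u}
  zero_mem' := by
    intro u u' c d _ _
    simp
  add_mem' := by
    intro x y hx hy u u' c d h₁ h₂
    simp only [Pi.add_apply, hx u u' c d h₁ h₂, hy u u' c d h₁ h₂]
    ring
  smul_mem' := by
    intro t x hx u u' c d h₁ h₂
    simp only [Pi.smul_apply, smul_eq_mul, hx u u' c d h₁ h₂]
    ring

/-- The line bundle `𝒪(a, b)` on `S`: its holomorphic sections are locally the restrictions of
holomorphic functions of `(w, z)`, homogeneous along the fibres as required. -/
def O (S : Set Q) (a b : ℤ) : PreBundle.{0} S where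
  fiber p := twistFiber a b p.1
  IsHolAt s p := ∀ u₀ : Lift p.1, ∃ F : C2C2 → ℂ, AnalyticAt ℂ F u₀.1 ∧
    ∀ᶠ u in 𝓝 u₀.1, ∀ (q : S) (h : IsLift u q.1), (s q).1 ⟨u, h⟩ = F u

end PreBundle

/-! ### Discrete Nahm data -/

/-- Endomorphisms `A r, B r, D r` of `V r` and maps `P⁺_r : V r → V (r+1)` (written `Pp r`) and
`P⁻_{r+1} : V (r+1) → V r` (written `Pm r`). -/
structure DNData (V : ℤ → Type u) [∀ r, AddCommGroup (V r)] [∀ r, Module ℂ (V r)] where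
  A : ∀ r, V r →ₗ[ℂ] V r
  B : ∀ r, V r →ₗ[ℂ] V r
  D : ∀ r, V r →ₗ[ℂ] V r
  Pp : ∀ r, V r →ₗ[ℂ] V (r + 1)
  Pm : ∀ r, V (r + 1) →ₗ[ℂ] V r

namespace DNData

variable {V : ℤ → Type u} [∀ r, AddCommGroup (V r)] [∀ r, Module ℂ (V r)]

/-- The discrete Nahm equations on `[r, r+1]`. -/
def SatisfiesDN (N : DNData V) (r : ℤ) : Prop :=
  N.Pm r ∘ₗ N.A (r + 1) - N.A r ∘ₗ N.Pm r = 0 ∧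
  N.Pp r ∘ₗ N.D r - N.D (r + 1) ∘ₗ N.Pp r = 0 ∧
  N.B r = N.Pm r ∘ₗ N.Pp r + N.A r ∘ₗ N.D r ∧
  N.B (r + 1) = N.Pp r ∘ₗ N.Pm r + N.D (r + 1) ∘ₗ N.A (r + 1)

/-- The discrete Nahm equations hold on `Z`: on `[r, r+1]` for all adjacent points of `Z`. Only
the data attached to the points of `Z` enter. -/
def IsSolutionOn (N : DNData V) (Z : Set ℤ) : Prop :=
  ∀ r, r ∈ Z → r + 1 ∈ Z → N.SatisfiesDN r

/-- All the maps `P^±` between adjacent points of `Z` are invertible. -/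
def InvertibleOn (N : DNData V) (Z : Set ℤ) : Prop :=
  ∀ r, r ∈ Z → r + 1 ∈ Z → Function.Bijective (N.Pp r) ∧ Function.Bijective (N.Pm r)

/-- `M_r = ηζ A_r + η B_r + ζ + D_r` in homogeneous coordinates `η = w₀/w₁`, `ζ = z₀/z₁`. -/
def M (N : DNData V) (r : ℤ) (u : C2C2) : V r →ₗ[ℂ] V r :=
  (u.1 0 * u.2 0) • N.A r + (u.1 0 * u.2 1) • N.B r + (u.1 1 * u.2 0) • LinearMap.id +
    (u.1 1 * u.2 1) • N.D r

/-- The equation `det M_r` of the spectral curve, as a function of homogeneous coordinates. -/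
noncomputable def spectralDet (N : DNData V) (r : ℤ) (u : C2C2) : ℂ :=
  LinearMap.det (N.M r u)

/-- Representative homogeneous coordinates of a point. -/
noncomputable def rep (p : Q) : C2C2 := (p.1.rep, p.2.rep)

/-- The spectral curve `S_r = {det M_r = 0}` in `ℙ₁ × ℙ₁`; as `det M_r` is bihomogeneous, the
choice of homogeneous coordinates does not matter. -/
def spectralCurve (N : DNData V) (r : ℤ) : Set Q :=
  {p | N.spectralDet r (rep p) = 0}

/-- The spectral curve `S_r` (the divisor of `det M_r`) is smooth: the differential of its
bihomogeneous equation vanishes at no point of it. -/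
def SmoothSpectralCurve (N : DNData V) (r : ℤ) : Prop :=
  ∀ u : C2C2, u.1 ≠ 0 → u.2 ≠ 0 → N.spectralDet r u = 0 → fderiv ℂ (N.spectralDet r) u ≠ 0

/-- The bundle `ℒ_r` on the curve `S`, the cokernel of
`M_r : V_r ⊗ 𝒪(-1,-1) → V_r ⊗ 𝒪`. The fibre at `p` is the cokernel of `M_r` at `p` (the image of
`M_r` does not depend on the homogeneous coordinates of `p`), and the holomorphic sections are
locally the classes of holomorphic `V_r`-valued functions. -/
noncomputable def spectralBundle (N : DNData V) (r : ℤ) (S : Set Q) : PreBundle.{u} S where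
  fiber p := V r ⧸ LinearMap.range (N.M r (rep p.1))
  IsHolAt s p := ∃ (n : ℕ) (f : Fin n → S → ℂ) (v : Fin n → V r),
    (∀ i, HolAt (f i) p) ∧
    ∀ᶠ q in 𝓝 p, s q = Submodule.Quotient.mk (∑ i, f i q • v i)

end DNData

end DiscreteNahm

/-! Write a = w₁ + w₀A_r and d = z₀ + z₁D_r, and a', d' for the same pencils at r + 1. The equations
for B say that M_r = ad + w₀z₁P⁻P⁺ and M_{r+1} = d'a' + w₀z₁P⁺P⁻, while P⁻a' = aP⁻ and P⁺d = d'P⁺.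
Hence det(1 + XY) = det(1 + YX) gives det M_r · det a' · det d' = det M_{r+1} · det a · det d
wherever a and d are invertible, and by density everywhere (`SatisfiesDN.spectralDet_mul`).

If P⁺ and P⁻ are invertible, they conjugate the pencils, so the extra factors agree and cancel. If
the curve is smooth, det M_r vanishes identically on no line of either ruling: otherwise its
transverse derivative along that line would be a form of positive degree on ℙ₁, which has a zero,
and this zero would be a singular point (`exists_fderiv_eq_zero`). Comparing root multiplicities on
suitable lines then forces A_r, A_{r+1} and D_r, D_{r+1} to have equal characteristic polynomials
(`charpoly_eq_of_mul_eq`), and the factors cancel again.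

Smoothness also makes the corank of M_r equal to one along the curve, since det has zero derivative
at a matrix of larger corank. A vector outside the image at one point then gives a local frame of
the cokernel, with coefficients analytic by Cramer's rule (`isFrameAt_spectralBundle`).

For the step, both M_r and M_{r+1} factor through V_r ⊕ V_{r+1}: M_r is `fstMap` after `fstLift`,
M_{r+1} is `sndMap` after `sndLift`, and the two mixed composites vanish. Both cokernels are
therefore the quotient of V_r ⊕ V_{r+1} by the sum of the images of the two lifts
(`SatisfiesDN.exists_cokernel_equiv`). Since `fstMap` is linear in w and `sndMap` is linear in z,
this identification is ℒ_r(1, 0) ≅ ℒ_{r+1}(0, 1), which is the twist by 𝒪(1, -1)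
(`SatisfiesDN.isIsomorphic_succ`). -/

namespace DiscreteNahm

/-! ### Homogeneous coordinates -/

/-- Nonzero vectors of `ℂ²`. -/
abbrev NonzeroVec : Type := {v : Fin 2 → ℂ // v ≠ 0}

/-- The point of the projective line with given homogeneous coordinates. -/
noncomputable def toP1 (v : NonzeroVec) : P1 := Projectivization.mk ℂ v.1 v.2

lemma continuous_toP1 : Continuous toP1 :=
  continuous_quotient_mk' (s := projectivizationSetoid ℂ (Fin 2 → ℂ))

/-- The saturation of an open set is the union of its preimages under the scalings by units. -/
lemma isOpenMap_toP1 : IsOpenMap toP1 := by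
  intro U hU
  have key : toP1 ⁻¹' (toP1 '' U) =
      ⋃ c : ℂˣ, (fun v : NonzeroVec => (⟨c • v.1, fun h =>
        v.2 ((smul_eq_zero_iff_eq c).1 h)⟩ : NonzeroVec)) ⁻¹' U := by
    ext v
    simp only [Set.mem_preimage, Set.mem_image, Set.mem_iUnion]
    constructor
    · rintro ⟨x, hx, h⟩
      obtain ⟨c, hc⟩ := (Projectivization.mk_eq_mk_iff ℂ _ _ x.2 v.2).1 h
      refine ⟨c, ?_⟩
      have : (⟨c • v.1, fun h => v.2 ((smul_eq_zero_iff_eq c).1 h)⟩ : NonzeroVec) = x := Subtype.ext hc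
      rw [this]
      exact hx
    · rintro ⟨c, hc⟩
      exact ⟨_, hc, (Projectivization.mk_eq_mk_iff ℂ _ _ _ v.2).2 ⟨c, rfl⟩⟩
  have : IsOpen (toP1 ⁻¹' (toP1 '' U)) := by
    rw [key]
    refine isOpen_iUnion fun c => hU.preimage ?_
    exact Continuous.subtype_mk (continuous_subtype_val.const_smul c) _
  exact this

lemma map_toP1_nhds (v : NonzeroVec) : map toP1 (𝓝 v) = 𝓝 (toP1 v) :=
  isOpenMap_toP1.map_nhds_eq continuous_toP1.continuousAt

lemma map_val_nhds (v : NonzeroVec) : map Subtype.val (𝓝 v) = 𝓝 v.1 :=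
  (isOpen_ne (x := (0 : Fin 2 → ℂ))).isOpenEmbedding_subtypeVal.map_nhds_eq v

lemma isLift_rep (p : Q) : IsLift (DNData.rep p) p :=
  ⟨p.1.rep_nonzero, p.2.rep_nonzero, p.1.mk_rep, p.2.mk_rep⟩

lemma IsLift.exists_smul {u u' : C2C2} {p : Q} (h : IsLift u p) (h' : IsLift u' p) :
    ∃ c d : ℂ, c ≠ 0 ∧ d ≠ 0 ∧ u'.1 = c • u.1 ∧ u'.2 = d • u.2 := by
  obtain ⟨h₁, h₂, e₁, e₂⟩ := h
  obtain ⟨h₁', h₂', e₁', e₂'⟩ := h'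
  obtain ⟨c, hc⟩ := (Projectivization.mk_eq_mk_iff ℂ _ _ h₁' h₁).1 (e₁'.trans e₁.symm)
  obtain ⟨d, hd⟩ := (Projectivization.mk_eq_mk_iff ℂ _ _ h₂' h₂).1 (e₂'.trans e₂.symm)
  exact ⟨c, d, c.ne_zero, d.ne_zero, hc.symm, hd.symm⟩

/-- A property holds near a point of `S` if and only if it holds for the points whose homogeneous
coordinates are near given ones of that point. -/
lemma eventually_iff_lift {S : Set Q} {p : S} {P : S → Prop} {u₀ : C2C2} (h : IsLift u₀ p.1) :
    (∀ᶠ q in 𝓝 p, P q) ↔ ∀ᶠ u in 𝓝 u₀, ∀ q : S, IsLift u q.1 → P q := by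
  obtain ⟨h₁, h₂, e₁, e₂⟩ := h
  -- Both neighbourhood filters are images of the one at a pair of nonzero vectors: under the open
  -- quotient map here, under the open embedding into ℂ² × ℂ² in `hu`.
  have hp : 𝓝 p.1 = map (Prod.map toP1 toP1)
      (𝓝 ((⟨u₀.1, h₁⟩, ⟨u₀.2, h₂⟩) : NonzeroVec × NonzeroVec)) := by
    rw [nhds_prod_eq (x := (⟨u₀.1, h₁⟩ : NonzeroVec)), ← prod_map_map_eq', map_toP1_nhds,
      map_toP1_nhds, ← nhds_prod_eq]
    exact congrArg 𝓝 (Prod.ext e₁.symm e₂.symm)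
  have hu : 𝓝 u₀ = map (Prod.map Subtype.val Subtype.val)
      (𝓝 ((⟨u₀.1, h₁⟩, ⟨u₀.2, h₂⟩) : NonzeroVec × NonzeroVec)) := by
    rw [nhds_prod_eq (x := (⟨u₀.1, h₁⟩ : NonzeroVec)), ← prod_map_map_eq', map_val_nhds,
      map_val_nhds, ← nhds_prod_eq]
  rw [nhds_subtype, eventually_comap, hp, hu, eventually_map, eventually_map]
  refine eventually_congr (Eventually.of_forall fun x => ?_)
  constructor
  · rintro H q ⟨_, _, f₁, f₂⟩
    exact H q (Prod.ext f₁.symm f₂.symm)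
  · rintro H q hq
    exact H q ⟨x.1.2, x.2.2, (congrArg Prod.fst hq).symm, (congrArg Prod.snd hq).symm⟩

/-! ### Holomorphic functions -/

variable {S : Set Q} {p : S} {f g : S → ℂ}

lemma HolAt.congr (hf : HolAt f p) (h : ∀ᶠ q in 𝓝 p, f q = g q) : HolAt g p := by
  intro u₀
  obtain ⟨F, hF, hfF⟩ := hf u₀
  refine ⟨F, hF, ?_⟩
  filter_upwards [hfF, (eventually_iff_lift u₀.2).1 h] with u h₁ h₂ q hq
  rw [← h₂ q hq, h₁ q hq]

lemma holAt_const (c : ℂ) : HolAt (fun _ => c) p := fun _ =>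
  ⟨fun _ => c, analyticAt_const, Eventually.of_forall fun _ _ _ => rfl⟩

lemma HolAt.add (hf : HolAt f p) (hg : HolAt g p) : HolAt (fun q => f q + g q) p := by
  intro u₀
  obtain ⟨F, hF, hfF⟩ := hf u₀
  obtain ⟨G, hG, hgG⟩ := hg u₀
  refine ⟨fun u => F u + G u, hF.add hG, ?_⟩
  filter_upwards [hfF, hgG] with u h₁ h₂ q hq
  rw [h₁ q hq, h₂ q hq]

lemma HolAt.mul (hf : HolAt f p) (hg : HolAt g p) : HolAt (fun q => f q * g q) p := by
  intro u₀
  obtain ⟨F, hF, hfF⟩ := hf u₀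
  obtain ⟨G, hG, hgG⟩ := hg u₀
  refine ⟨fun u => F u * G u, hF.mul hG, ?_⟩
  filter_upwards [hfF, hgG] with u h₁ h₂ q hq
  rw [h₁ q hq, h₂ q hq]

lemma holAt_sum {ι : Type*} (s : Finset ι) {f : ι → S → ℂ} (hf : ∀ i ∈ s, HolAt (f i) p) :
    HolAt (fun q => ∑ i ∈ s, f i q) p := by
  classical
  induction s using Finset.induction_on with
  | empty => simpa using holAt_const (p := p) 0
  | insert i s hi ih =>
    simp only [Finset.sum_insert hi]
    exact (hf i (s.mem_insert_self i)).add (ih fun j hj => hf j (Finset.mem_insert_of_mem hj))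

lemma HolAt.inv (hf : HolAt f p) (hp : f p ≠ 0) : HolAt (fun q => (f q)⁻¹) p := by
  intro u₀
  obtain ⟨F, hF, hfF⟩ := hf u₀
  refine ⟨fun u => (F u)⁻¹, hF.inv ?_, ?_⟩
  · rw [← hfF.self_of_nhds p u₀.2]
    exact hp
  · filter_upwards [hfF] with u h₁ q hq
    rw [h₁ q hq]

lemma HolAt.eventually_ne (hf : HolAt f p) (hp : f p ≠ 0) : ∀ᶠ q in 𝓝 p, f q ≠ 0 := by
  obtain ⟨F, hF, hfF⟩ := hf ⟨_, isLift_rep p.1⟩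
  have h0 : F (DNData.rep p.1) ≠ 0 := by
    rw [← hfF.self_of_nhds p (isLift_rep p.1)]
    exact hp
  rw [eventually_iff_lift (isLift_rep p.1)]
  filter_upwards [hfF, hF.continuousAt.eventually_ne h0] with u h₁ h₂ q hq
  rw [h₁ q hq]
  exact h₂

lemma eventually_rep_fst_ne {i : Fin 2} (h : (DNData.rep p.1).1 i ≠ 0) :
    ∀ᶠ q in 𝓝 p, (DNData.rep q.1).1 i ≠ 0 := by
  rw [eventually_iff_lift (isLift_rep p.1)]
  have hc : Continuous fun u : C2C2 => u.1 i := by fun_prop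
  filter_upwards [hc.continuousAt.eventually_ne h] with u hu q hq
  obtain ⟨c, d, hc, -, h₁, -⟩ := hq.exists_smul (isLift_rep q.1)
  rw [h₁]
  simpa [hc] using hu

lemma eventually_rep_snd_ne {i : Fin 2} (h : (DNData.rep p.1).2 i ≠ 0) :
    ∀ᶠ q in 𝓝 p, (DNData.rep q.1).2 i ≠ 0 := by
  rw [eventually_iff_lift (isLift_rep p.1)]
  have hc : Continuous fun u : C2C2 => u.2 i := by fun_prop
  filter_upwards [hc.continuousAt.eventually_ne h] with u hu q hq
  obtain ⟨c, d, -, hd, -, h₂⟩ := hq.exists_smul (isLift_rep q.1)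
  rw [h₂]
  simpa [hd] using hu

lemma holAt_fst_div {i : Fin 2} (j : Fin 2) (h : (DNData.rep p.1).1 i ≠ 0) :
    HolAt (fun q : S => (DNData.rep q.1).1 j / (DNData.rep q.1).1 i) p := by
  intro u₀
  refine ⟨fun u => u.1 j / u.1 i, ?_, Eventually.of_forall fun u q hq => ?_⟩
  · obtain ⟨c, d, hc, -, h₁, -⟩ := u₀.2.exists_smul (isLift_rep p.1)
    have : u₀.1.1 i ≠ 0 := by
      rintro h0
      simp [h₁, h0] at h
    have key : ∀ k : Fin 2, AnalyticAt ℂ (fun u : C2C2 => u.1 k) u₀.1 := fun k =>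
      ((ContinuousLinearMap.proj (R := ℂ) (φ := fun _ : Fin 2 => ℂ) k).comp
        (ContinuousLinearMap.fst ℂ (Fin 2 → ℂ) (Fin 2 → ℂ))).analyticAt _
    exact (key j).div (key i) this
  · obtain ⟨c, d, hc, -, h₁, -⟩ := hq.exists_smul (isLift_rep q.1)
    simp only [h₁, Pi.smul_apply, smul_eq_mul]
    exact mul_div_mul_left _ _ hc

lemma holAt_snd_div {i : Fin 2} (j : Fin 2) (h : (DNData.rep p.1).2 i ≠ 0) :
    HolAt (fun q : S => (DNData.rep q.1).2 j / (DNData.rep q.1).2 i) p := by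
  intro u₀
  refine ⟨fun u => u.2 j / u.2 i, ?_, Eventually.of_forall fun u q hq => ?_⟩
  · obtain ⟨c, d, -, hd, -, h₁⟩ := u₀.2.exists_smul (isLift_rep p.1)
    have : u₀.1.2 i ≠ 0 := by
      rintro h0
      simp [h₁, h0] at h
    have key : ∀ k : Fin 2, AnalyticAt ℂ (fun u : C2C2 => u.2 k) u₀.1 := fun k =>
      ((ContinuousLinearMap.proj (R := ℂ) (φ := fun _ : Fin 2 => ℂ) k).comp
        (ContinuousLinearMap.snd ℂ (Fin 2 → ℂ) (Fin 2 → ℂ))).analyticAt _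
    exact (key j).div (key i) this
  · obtain ⟨c, d, -, hd, -, h₁⟩ := hq.exists_smul (isLift_rep q.1)
    simp only [h₁, Pi.smul_apply, smul_eq_mul]
    exact mul_div_mul_left _ _ hd

/-! ### Local frames and the calculus of line bundles -/

namespace PreBundle

variable {S : Set Q}

/-- Near `p`, the holomorphic sections are exactly the multiples of `e` by holomorphic
functions. -/
def IsFrameAt (E : PreBundle.{u} S) (e : ∀ q, E.fiber q) (p : S) : Prop :=
  ∀ s : ∀ q, E.fiber q, E.IsHolAt s p ↔ ∃ f : S → ℂ, HolAt f p ∧ ∀ᶠ x in 𝓝 p, s x = f x • e x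

/-- There is a frame near every point. -/
def HasFrames (E : PreBundle.{u} S) : Prop := ∀ p, ∃ e, E.IsFrameAt e p

variable {E : PreBundle.{u} S} {F : PreBundle.{v} S}

lemma IsFrameAt.isHolAt {e : ∀ q, E.fiber q} {p : S} (he : E.IsFrameAt e p) : E.IsHolAt e p :=
  (he e).2 ⟨fun _ => 1, holAt_const 1, Eventually.of_forall fun _ => (one_smul _ _).symm⟩

/-- A holomorphic section that does not vanish at `p` is a frame near `p`. -/
lemma IsFrameAt.of_ne_zero {e s : ∀ q, E.fiber q} {p : S} (he : E.IsFrameAt e p)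
    (hs : E.IsHolAt s p) (h : s p ≠ 0) : E.IsFrameAt s p := by
  obtain ⟨g, hg, hsg⟩ := (he s).1 hs
  have hgp : g p ≠ 0 := by
    intro h0
    rw [hsg.self_of_nhds, h0, zero_smul] at h
    exact h rfl
  intro t
  rw [he t]
  constructor
  · rintro ⟨f, hf, htf⟩
    refine ⟨fun q => f q * (g q)⁻¹, hf.mul (hg.inv hgp), ?_⟩
    filter_upwards [htf, hsg, hg.eventually_ne hgp] with q h₁ h₂ h₃
    rw [h₁, h₂, smul_smul, mul_assoc, inv_mul_cancel₀ h₃, mul_one]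
  · rintro ⟨f, hf, htf⟩
    refine ⟨fun q => f q * g q, hf.mul hg, ?_⟩
    filter_upwards [htf, hsg] with q h₁ h₂
    rw [h₁, h₂, smul_smul]

/-- Fibrewise linear maps commute with multiplication by functions, so holomorphy needs checking
only on one frame near each point. -/
lemma isIsomorphic_of_frames (φ : ∀ p, E.fiber p ≃ₗ[ℂ] F.fiber p)
    (h : ∀ p, ∃ e, E.IsFrameAt e p ∧ F.IsFrameAt (fun q => φ q (e q)) p) :
    E.IsIsomorphic F := by
  refine ⟨φ, fun s p => ?_⟩
  obtain ⟨e, he, hf⟩ := h p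
  rw [he s, hf]
  refine exists_congr fun f => and_congr_right fun _ => eventually_congr ?_
  refine Eventually.of_forall fun q => ?_
  rw [← map_smul]
  exact (φ q).injective.eq_iff

lemma IsFrameAt.map {φ : ∀ p, E.fiber p ≃ₗ[ℂ] F.fiber p}
    (hφ : ∀ (s : ∀ p, E.fiber p) (p : S), F.IsHolAt (fun q => φ q (s q)) p ↔ E.IsHolAt s p)
    {e : ∀ q, E.fiber q} {p : S} (he : E.IsFrameAt e p) :
    F.IsFrameAt (fun q => φ q (e q)) p := by
  intro t
  have := hφ (fun q => (φ q).symm (t q)) p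
  simp only [LinearEquiv.apply_symm_apply] at this
  rw [this, he]
  refine exists_congr fun f => and_congr_right fun _ => eventually_congr ?_
  refine Eventually.of_forall fun q => ?_
  rw [← map_smul, LinearEquiv.symm_apply_eq]

lemma IsIsomorphic.symm (h : E.IsIsomorphic F) : F.IsIsomorphic E := by
  obtain ⟨φ, hφ⟩ := h
  refine ⟨fun p => (φ p).symm, fun s p => ?_⟩
  rw [← hφ]
  simp only [LinearEquiv.apply_symm_apply]

lemma IsIsomorphic.trans {G : PreBundle S} (h : E.IsIsomorphic F)
    (h' : F.IsIsomorphic G) : E.IsIsomorphic G := by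
  obtain ⟨φ, hφ⟩ := h
  obtain ⟨ψ, hψ⟩ := h'
  refine ⟨fun p => (φ p).trans (ψ p), fun s p => ?_⟩
  rw [← hφ, ← hψ]
  rfl

lemma isFrameAt_trivial (p : S) : (trivial S).IsFrameAt (fun _ => (1 : ℂ)) p := by
  intro s
  constructor
  · intro hs
    exact ⟨s, hs, Eventually.of_forall fun q => (mul_one (M := ℂ) (s q)).symm⟩
  · rintro ⟨f, hf, h⟩
    refine HolAt.congr hf ?_
    filter_upwards [h] with q hq
    rw [hq]
    exact (mul_one (f q)).symm

lemma hasFrames_trivial : (trivial S).HasFrames := fun p => ⟨_, isFrameAt_trivial p⟩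

lemma IsFrameAt.tensor {e : ∀ q, E.fiber q} {f : ∀ q, F.fiber q} {p : S}
    (he : E.IsFrameAt e p) (hf : F.IsFrameAt f p) :
    (E.tensor F).IsFrameAt (fun q => e q ⊗ₜ[ℂ] f q) p := by
  intro s
  constructor
  · rintro ⟨n, a, b, ha, hb, hs⟩
    choose α hα haα using fun i => (he (a i)).1 (ha i)
    choose β hβ hbβ using fun i => (hf (b i)).1 (hb i)
    refine ⟨fun q => ∑ i, α i q * β i q, holAt_sum _ fun i _ => (hα i).mul (hβ i), ?_⟩
    filter_upwards [hs, eventually_all.2 haα, eventually_all.2 hbβ] with q h₁ h₂ h₃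
    rw [h₁]
    change _ = (∑ i, α i q * β i q) • (e q ⊗ₜ[ℂ] f q)
    rw [Finset.sum_smul]
    refine Finset.sum_congr rfl fun i _ => ?_
    rw [h₂, h₃, TensorProduct.smul_tmul_smul]
  · rintro ⟨g, hg, hs⟩
    refine ⟨1, fun _ q => g q • e q, fun _ => f, fun _ => (he _).2 ⟨g, hg, Eventually.of_forall
      fun _ => rfl⟩, fun _ => hf.isHolAt, ?_⟩
    filter_upwards [hs] with q hq
    rw [hq, Fin.sum_univ_one, ← TensorProduct.smul_tmul']
    rfl

lemma HasFrames.tensor (hE : E.HasFrames) (hF : F.HasFrames) : (E.tensor F).HasFrames := by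
  intro p
  obtain ⟨e, he⟩ := hE p
  obtain ⟨f, hf⟩ := hF p
  exact ⟨_, he.tensor hf⟩

lemma HasFrames.isIsomorphic_tensor_trivial (hE : E.HasFrames) :
    E.IsIsomorphic (E.tensor (trivial S)) := by
  refine isIsomorphic_of_frames (fun p => (TensorProduct.rid ℂ (E.fiber p)).symm) fun p => ?_
  obtain ⟨e, he⟩ := hE p
  exact ⟨e, he, he.tensor (isFrameAt_trivial p)⟩

lemma HasFrames.isIsomorphic_tensor_assoc {G : PreBundle.{0} S} (hE : E.HasFrames)
    (hF : F.HasFrames) (hG : G.HasFrames) :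
    ((E.tensor F).tensor G).IsIsomorphic (E.tensor (F.tensor G)) := by
  refine isIsomorphic_of_frames
    (fun p => TensorProduct.assoc ℂ (E.fiber p) (F.fiber p) (G.fiber p)) fun p => ?_
  obtain ⟨e, he⟩ := hE p
  obtain ⟨f, hf⟩ := hF p
  obtain ⟨g, hg⟩ := hG p
  exact ⟨_, (he.tensor hf).tensor hg, he.tensor (hf.tensor hg)⟩

lemma IsIsomorphic.tensor_right {E' : PreBundle.{v} S} {G : PreBundle.{0} S}
    (h : E.IsIsomorphic E') (hE : E.HasFrames) (hG : G.HasFrames) :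
    (E.tensor G).IsIsomorphic (E'.tensor G) := by
  obtain ⟨φ, hφ⟩ := h
  refine isIsomorphic_of_frames
    (fun p => TensorProduct.congr (φ p) (LinearEquiv.refl ℂ (G.fiber p))) fun p => ?_
  obtain ⟨e, he⟩ := hE p
  obtain ⟨g, hg⟩ := hG p
  exact ⟨_, he.tensor hg, (he.map hφ).tensor hg⟩

lemma IsIsomorphic.tensor_left {F' : PreBundle.{v} S}
    (h : F.IsIsomorphic F') (hE : E.HasFrames) (hF : F.HasFrames) :
    (E.tensor F).IsIsomorphic (E.tensor F') := by
  obtain ⟨φ, hφ⟩ := h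
  refine isIsomorphic_of_frames
    (fun p => TensorProduct.congr (LinearEquiv.refl ℂ (E.fiber p)) (φ p)) fun p => ?_
  obtain ⟨e, he⟩ := hE p
  obtain ⟨g, hg⟩ := hF p
  exact ⟨_, he.tensor hg, he.tensor (hg.map hφ)⟩

/-- The dual frame. -/
lemma IsFrameAt.dual {e : ∀ q, E.fiber q} {ε : ∀ q, Module.Dual ℂ (E.fiber q)} {p : S}
    (hfin : ∀ q, Module.finrank ℂ (E.fiber q) = 1) (he : E.IsFrameAt e p)
    (hε : ∀ᶠ q in 𝓝 p, ε q (e q) = 1) : E.dual.IsFrameAt ε p := by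
  intro s
  constructor
  · intro hs
    -- The coefficient of `s` is its pairing with the frame `e`.
    refine ⟨_, hs e he.isHolAt, ?_⟩
    filter_upwards [hε] with q hq
    have he0 : e q ≠ 0 := by
      intro h0
      simp [h0] at hq
    refine LinearMap.ext fun x => ?_
    obtain ⟨c, rfl⟩ := (finrank_eq_one_iff_of_nonzero' (e q) he0).1 (hfin q) x
    let t : Module.Dual ℂ (E.fiber q) := s q
    change t (c • e q) = t (e q) * ε q (c • e q)
    rw [map_smul, map_smul, hq, smul_eq_mul, smul_eq_mul, mul_one, mul_comm]
  · rintro ⟨f, hf, hsf⟩ a ha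
    obtain ⟨g, hg, hag⟩ := (he a).1 ha
    refine (hf.mul hg).congr ?_
    filter_upwards [hε, hsf, hag] with q h₁ h₂ h₃
    rw [h₂, h₃]
    change f q * g q = f q * ε q (g q • e q)
    rw [map_smul, h₁, smul_eq_mul, mul_one]

/-- A frame that vanishes nowhere near the point has a dual frame. -/
lemma IsFrameAt.exists_dual {e : ∀ q, E.fiber q} {p : S}
    (hfin : ∀ q, Module.finrank ℂ (E.fiber q) = 1) (he : E.IsFrameAt e p)
    (h0 : ∀ᶠ q in 𝓝 p, e q ≠ 0) :
    ∃ ε : ∀ q, Module.Dual ℂ (E.fiber q), (∀ᶠ q in 𝓝 p, ε q (e q) = 1) ∧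
      E.dual.IsFrameAt ε p := by
  have : ∀ q, ∃ ε : Module.Dual ℂ (E.fiber q), e q ≠ 0 → ε (e q) = 1 := by
    intro q
    by_cases h : e q = 0
    -- Sections are defined on all of `S`; away from `p`, where `e` may vanish, any value will do.
    · exact ⟨0, fun h' => (h' h).elim⟩
    · obtain ⟨ε, hε⟩ := Module.Projective.exists_dual_eq_one ℂ h
      exact ⟨ε, fun _ => hε⟩
  choose ε hε using this
  have h1 : ∀ᶠ q in 𝓝 p, ε q (e q) = 1 := h0.mono fun q hq => hε q hq
  exact ⟨ε, h1, he.dual hfin h1⟩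

/-- A line bundle tensored with its dual is trivial. -/
lemma isIsomorphic_trivial_tensor_dual (hfin : ∀ q, Module.finrank ℂ (E.fiber q) = 1)
    (hE : ∀ p, ∃ e, E.IsFrameAt e p ∧ ∀ᶠ q in 𝓝 p, e q ≠ 0) :
    (E.tensor E.dual).IsIsomorphic (trivial S) := by
  -- Contraction is a nonzero map between one-dimensional spaces.
  have hb : ∀ q, Function.Bijective (contractRight ℂ (E.fiber q)) := by
    intro q
    have : FiniteDimensional ℂ (E.fiber q) := Module.finite_of_finrank_eq_succ (hfin q)
    have hd : Module.finrank ℂ (E.fiber q ⊗[ℂ] Module.Dual ℂ (E.fiber q)) =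
        Module.finrank ℂ ℂ := by
      rw [Module.finrank_tensorProduct, Subspace.dual_finrank_eq, hfin, Module.finrank_self]
    have hs : Function.Surjective (contractRight ℂ (E.fiber q)) := by
      obtain ⟨v, hv, -⟩ := finrank_eq_one_iff'.1 (hfin q)
      obtain ⟨ε, hε⟩ := Module.Projective.exists_dual_eq_one ℂ hv
      intro c
      exact ⟨v ⊗ₜ (c • ε), by simp [hε]⟩
    exact ⟨(LinearMap.injective_iff_surjective_of_finrank_eq_finrank hd).2 hs, hs⟩
  refine isIsomorphic_of_frames (fun q => LinearEquiv.ofBijective _ (hb q)) fun p => ?_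
  obtain ⟨e, he, h0⟩ := hE p
  obtain ⟨ε, hε, hd⟩ := he.exists_dual hfin h0
  refine ⟨_, he.tensor hd, (isFrameAt_trivial p).of_ne_zero ?_ ?_⟩
  · refine (holAt_const 1).congr ?_
    filter_upwards [hε] with q hq
    exact hq.symm
  · have := hε.self_of_nhds
    change ε p (e p) ≠ 0
    rw [this]
    exact one_ne_zero

lemma HasFrames.npow {L : PreBundle.{0} S} (hL : L.HasFrames) (n : ℕ) : (L.npow n).HasFrames := by
  induction n with
  | zero => exact hasFrames_trivial
  | succ n ih => exact ih.tensor hL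

/-- A sequence of bundles with `E (n + 1) ≅ E n ⊗ L` satisfies `E n ≅ E 0 ⊗ Lⁿ`. -/
lemma isIsomorphic_tensor_npow {L : PreBundle.{0} S} (hL : L.HasFrames)
    (E : ℕ → PreBundle.{u} S) (m : ℕ) (hE : ∀ n ≤ m, (E n).HasFrames)
    (h : ∀ n < m, (E (n + 1)).IsIsomorphic ((E n).tensor L)) :
    (E m).IsIsomorphic ((E 0).tensor (L.npow m)) := by
  induction m with
  | zero => exact (hE 0 le_rfl).isIsomorphic_tensor_trivial
  | succ m ih =>
    have h₁ := ih (fun n hn => hE n (hn.trans m.le_succ)) fun n hn => h n (hn.trans m.lt_succ_self)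
    have h₂ := h₁.tensor_right (hE m m.le_succ) hL
    exact ((h m m.lt_succ_self).trans h₂).trans
      ((hE 0 (Nat.zero_le _)).isIsomorphic_tensor_assoc (hL.npow m) hL)

end PreBundle

namespace PreBundle

/-! ### The bundle `𝒪(1, -1)` -/

/-- The function `w i / z j` of homogeneous coordinates, as a section of `𝒪(1, -1)`. -/
noncomputable def coordRatio (i j : Fin 2) (q : Q) : twistFiber 1 (-1) q :=
  ⟨fun u => u.1.1 i / u.1.2 j, by
    intro u u' c d h₁ h₂
    simp only [h₁, h₂, Pi.smul_apply, smul_eq_mul, zpow_one, zpow_neg]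
    rw [mul_div_mul_comm, div_eq_mul_inv c d]⟩

/-- Multiplying by z_j / w_i lowers the bidegree to (0, 0), which leaves a function of the point
alone. This is the coefficient relative to `coordRatio i j`. -/
lemma twistFiber_mul_eq {q : Q} (h : twistFiber 1 (-1) q) (u u' : Lift q) (i j : Fin 2) :
    h.1 u' * (u'.1.2 j / u'.1.1 i) = h.1 u * (u.1.2 j / u.1.1 i) := by
  obtain ⟨c, d, hc, hd, h₁, h₂⟩ := u.2.exists_smul u'.2
  rw [h.2 u u' c d h₁ h₂, h₁, h₂]
  simp only [Pi.smul_apply, smul_eq_mul, zpow_one, zpow_neg]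
  rw [mul_div_mul_comm]
  field_simp

lemma twistFiber_eq_smul {q : Q} (h : twistFiber 1 (-1) q) (u : Lift q) {i j : Fin 2}
    (hi : u.1.1 i ≠ 0) (hj : u.1.2 j ≠ 0) :
    h = (h.1 u * (u.1.2 j / u.1.1 i)) • coordRatio i j q := by
  refine Subtype.ext (funext fun u' => ?_)
  have hi' : u'.1.1 i ≠ 0 := by
    obtain ⟨c, d, hc, hd, h₁, h₂⟩ := u.2.exists_smul u'.2
    simp [h₁, hc, hi]
  have hj' : u'.1.2 j ≠ 0 := by
    obtain ⟨c, d, hc, hd, h₁, h₂⟩ := u.2.exists_smul u'.2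
    simp [h₂, hd, hj]
  rw [← twistFiber_mul_eq h u u']
  change h.1 u' = h.1 u' * (u'.1.2 j / u'.1.1 i) * (u'.1.1 i / u'.1.2 j)
  field_simp

lemma coordRatio_ne_zero {q : Q} {i j : Fin 2} (hi : (DNData.rep q).1 i ≠ 0)
    (hj : (DNData.rep q).2 j ≠ 0) : coordRatio i j q ≠ 0 := by
  intro h
  have := congrFun (congrArg Subtype.val h) ⟨_, isLift_rep q⟩
  exact div_ne_zero hi hj this

lemma exists_rep_fst_ne (q : Q) : ∃ i, (DNData.rep q).1 i ≠ 0 :=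
  Function.ne_iff.1 q.1.rep_nonzero

lemma exists_rep_snd_ne (q : Q) : ∃ i, (DNData.rep q).2 i ≠ 0 :=
  Function.ne_iff.1 q.2.rep_nonzero

lemma finrank_twistFiber (q : Q) : Module.finrank ℂ (twistFiber 1 (-1) q) = 1 := by
  obtain ⟨i, hi⟩ := exists_rep_fst_ne q
  obtain ⟨j, hj⟩ := exists_rep_snd_ne q
  exact (finrank_eq_one_iff_of_nonzero' _ (coordRatio_ne_zero hi hj)).2 fun h =>
    ⟨_, (twistFiber_eq_smul h ⟨_, isLift_rep q⟩ hi hj).symm⟩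

variable {S : Set Q}

lemma isFrameAt_coordRatio {p : S} {i j : Fin 2} (hi : (DNData.rep p.1).1 i ≠ 0)
    (hj : (DNData.rep p.1).2 j ≠ 0) :
    (O S 1 (-1)).IsFrameAt (fun q => coordRatio i j q.1) p := by
  have key₁ : ∀ (u₀ : Lift p.1) (k : Fin 2), AnalyticAt ℂ (fun u : C2C2 => u.1 k) u₀.1 :=
    fun u₀ k => ((ContinuousLinearMap.proj (R := ℂ) (φ := fun _ : Fin 2 => ℂ) k).comp
      (ContinuousLinearMap.fst ℂ (Fin 2 → ℂ) (Fin 2 → ℂ))).analyticAt _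
  have key₂ : ∀ (u₀ : Lift p.1) (k : Fin 2), AnalyticAt ℂ (fun u : C2C2 => u.2 k) u₀.1 :=
    fun u₀ k => ((ContinuousLinearMap.proj (R := ℂ) (φ := fun _ : Fin 2 => ℂ) k).comp
      (ContinuousLinearMap.snd ℂ (Fin 2 → ℂ) (Fin 2 → ℂ))).analyticAt _
  have hne : ∀ u₀ : Lift p.1, u₀.1.1 i ≠ 0 ∧ u₀.1.2 j ≠ 0 := by
    intro u₀
    obtain ⟨c, d, hc, hd, h₁, h₂⟩ := (isLift_rep p.1).exists_smul u₀.2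
    exact ⟨by simp [h₁, hc, hi], by simp [h₂, hd, hj]⟩
  intro s
  constructor
  · intro hs
    refine ⟨fun q => (s q).1 ⟨_, isLift_rep q.1⟩ *
      ((DNData.rep q.1).2 j / (DNData.rep q.1).1 i), fun u₀ => ?_, ?_⟩
    · obtain ⟨F, hF, hsF⟩ := hs u₀
      refine ⟨fun u => F u * (u.2 j / u.1 i),
        hF.mul ((key₂ u₀ j).div (key₁ u₀ i) (hne u₀).1), ?_⟩
      filter_upwards [hsF] with u hu q hq
      rw [← hu q hq]
      exact twistFiber_mul_eq (s q) ⟨u, hq⟩ ⟨_, isLift_rep q.1⟩ i j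
    · filter_upwards [eventually_rep_fst_ne hi, eventually_rep_snd_ne hj] with q h₁ h₂
      exact twistFiber_eq_smul (s q) ⟨_, isLift_rep q.1⟩ h₁ h₂
  · rintro ⟨f, hf, hs⟩ u₀
    obtain ⟨F, hF, hfF⟩ := hf u₀
    refine ⟨fun u => F u * (u.1 i / u.2 j),
      hF.mul ((key₁ u₀ i).div (key₂ u₀ j) (hne u₀).2), ?_⟩
    filter_upwards [hfF, (eventually_iff_lift u₀.2).1 hs] with u h₁ h₂ q hq
    rw [h₂ q hq, ← h₁ q hq]
    rfl

lemma exists_isFrameAt_O (p : S) :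
    ∃ e, (O S 1 (-1)).IsFrameAt e p ∧ ∀ᶠ q in 𝓝 p, e q ≠ 0 := by
  obtain ⟨i, hi⟩ := exists_rep_fst_ne p.1
  obtain ⟨j, hj⟩ := exists_rep_snd_ne p.1
  refine ⟨_, isFrameAt_coordRatio hi hj, ?_⟩
  filter_upwards [eventually_rep_fst_ne hi, eventually_rep_snd_ne hj] with q h₁ h₂
  exact coordRatio_ne_zero h₁ h₂

lemma hasFrames_O : (O S 1 (-1)).HasFrames := fun p =>
  let ⟨e, he, _⟩ := exists_isFrameAt_O p
  ⟨e, he⟩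

lemma hasFrames_dual_O : (O S 1 (-1)).dual.HasFrames := by
  intro p
  obtain ⟨e, he, h0⟩ := exists_isFrameAt_O p
  obtain ⟨ε, -, hε⟩ := he.exists_dual (fun q => finrank_twistFiber q.1) h0
  exact ⟨ε, hε⟩

/-- If `F ≅ E ⊗ 𝒪(1, -1)` then `E ≅ F ⊗ 𝒪(1, -1)ᵛ`. -/
lemma IsIsomorphic.tensor_dual_O {E F : PreBundle.{u} S} (hE : E.HasFrames)
    (h : F.IsIsomorphic (E.tensor (O S 1 (-1)))) :
    E.IsIsomorphic (F.tensor (O S 1 (-1)).dual) := by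
  have hd := isIsomorphic_trivial_tensor_dual (fun q => finrank_twistFiber q.1)
    (exists_isFrameAt_O (S := S))
  have h₁ := h.symm.tensor_right (hE.tensor hasFrames_O) hasFrames_dual_O
  have h₂ := hE.isIsomorphic_tensor_assoc (hasFrames_O (S := S)) hasFrames_dual_O
  have h₃ := hd.tensor_left hE (hasFrames_O.tensor hasFrames_dual_O)
  -- The chain is E ≅ E ⊗ 1 ≅ E ⊗ (𝒪(1,-1) ⊗ 𝒪(1,-1)ᵛ) ≅ (E ⊗ 𝒪(1,-1)) ⊗ 𝒪(1,-1)ᵛ ≅ F ⊗ 𝒪(1,-1)ᵛ.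
  exact ((hE.isIsomorphic_tensor_trivial.trans h₃.symm).trans h₂.symm).trans h₁

end PreBundle

/-! ### Determinants depending on parameters -/

lemma contDiff_det {ι X : Type*} [Fintype ι] [DecidableEq ι] [NormedAddCommGroup X]
    [NormedSpace ℂ X] {n : WithTop ℕ∞} {T : X → Matrix ι ι ℂ}
    (h : ∀ i j, ContDiff ℂ n fun u => T u i j) : ContDiff ℂ n fun u => (T u).det := by
  simp only [Matrix.det_apply]
  exact ContDiff.sum fun σ _ => (contDiff_prod fun i _ => h _ _).const_smul _

lemma analyticAt_det {ι X : Type*} [Fintype ι] [DecidableEq ι] [NormedAddCommGroup X]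
    [NormedSpace ℂ X] {T : X → Matrix ι ι ℂ} {u : X}
    (h : ∀ i j, AnalyticAt ℂ (fun u => T u i j) u) : AnalyticAt ℂ (fun u => (T u).det) u := by
  simp only [Matrix.det_apply']
  exact Finset.analyticAt_fun_sum _ fun σ _ =>
    analyticAt_const.mul (Finset.analyticAt_fun_prod _ fun i _ => h _ _)

/-- The derivative of the determinant vanishes at a matrix with two vanishing columns. -/
lemma fderiv_det_eq_zero {ι X : Type*} [Fintype ι] [DecidableEq ι] [NormedAddCommGroup X]
    [NormedSpace ℂ X] {T : X → Matrix ι ι ℂ} {u : X}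
    (h : ∀ i j, DifferentiableAt ℂ (fun u => T u i j) u) {i₀ i₁ : ι} (hne : i₀ ≠ i₁)
    (h₀ : ∀ i, T u i i₀ = 0) (h₁ : ∀ i, T u i i₁ = 0) : fderiv ℂ (fun u => (T u).det) u = 0 := by
  refine HasFDerivAt.fderiv ?_
  simp only [Matrix.det_apply]
  rw [← Finset.sum_const_zero (ι := Equiv.Perm ι) (s := Finset.univ)]
  refine HasFDerivAt.fun_sum fun σ _ => ?_
  rw [← smul_zero (Equiv.Perm.sign σ)]
  refine HasFDerivAt.fun_const_smul (c := Equiv.Perm.sign σ) ?_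
  have key := HasFDerivAt.finsetProd (u := Finset.univ) (g := fun i u => T u (σ i) i)
    (x := u) fun i _ => (h (σ i) i).hasFDerivAt
  refine (key.congr_fderiv (Finset.sum_eq_zero fun i _ => ?_)).congr_of_eventuallyEq
    (Eventually.of_forall fun v => by simp)
  -- The product rule removes one column from the product; at least one of the two vanishing columns
  -- remains.
  have h0 : ∏ j ∈ Finset.univ.erase i, T u (σ j) j = 0 := by
    by_cases hi : i = i₀
    · exact Finset.prod_eq_zero (Finset.mem_erase.2 ⟨hi ▸ hne.symm, Finset.mem_univ i₁⟩) (h₁ _)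
    · exact Finset.prod_eq_zero (Finset.mem_erase.2 ⟨Ne.symm hi, Finset.mem_univ i₀⟩) (h₀ _)
  exact (congrArg (fun c : ℂ => c • fderiv ℂ (fun u => T u (σ i) i) u) h0).trans
    (zero_smul ℂ (fderiv ℂ (fun u => T u (σ i) i) u))

/-! ### Zeros of the differential of a bihomogeneous function -/

/-- Along the line over `w` only the derivative `G` in a direction `e` transverse to `w` can
survive. It is homogeneous of degree `k` in z. If it had no zero, 1 / G(x, 1) would be entire and
tend to 0 at infinity, hence vanish by Liouville's theorem. -/
lemma exists_fderiv_eq_zero {F : C2C2 → ℂ} (hF : ContDiff ℂ 2 F) {k : ℕ} (hk : k ≠ 0)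
    (hw : ∀ (c : ℂ) w z, F (c • w, z) = c ^ k * F (w, z))
    (hz : ∀ (c : ℂ) w z, F (w, c • z) = c ^ k * F (w, z))
    {w : Fin 2 → ℂ} (hw0 : w ≠ 0) (h : ∀ z, F (w, z) = 0) :
    ∃ z : Fin 2 → ℂ, z ≠ 0 ∧ fderiv ℂ F (w, z) = 0 := by
  have hd : Differentiable ℂ F := hF.differentiable (by norm_num)
  have hline : ∀ u v, fderiv ℂ F u v = deriv (fun t : ℂ => F (u + t • v)) 0 := fun u v =>
    ((hd u).lineDeriv_eq_fderiv (v := v)).symm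
  obtain ⟨e, he⟩ : ∃ e : Fin 2 → ℂ, ∀ a : Fin 2 → ℂ, ∃ α β : ℂ, a = α • w + β • e := by
    by_cases h0 : w 0 = 0
    · have h1 : w 1 ≠ 0 := by
        intro h1
        exact hw0 (funext fun i => by fin_cases i <;> assumption)
      refine ⟨![1, 0], fun a => ⟨a 1 / w 1, a 0, funext fun i => ?_⟩⟩
      fin_cases i <;> simp [h0, h1]
    · refine ⟨![0, 1], fun a => ⟨a 0 / w 0, a 1 - a 0 / w 0 * w 1, funext fun i => ?_⟩⟩
      fin_cases i <;> simp [h0]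
  let G : (Fin 2 → ℂ) → ℂ := fun z => fderiv ℂ F (w, z) (e, 0)
  have hGd : Differentiable ℂ G := by
    have h1 : ContDiff ℂ 1 (fderiv ℂ F) := hF.fderiv_right (by norm_num)
    have h2 : Differentiable ℂ (fderiv ℂ F) := h1.differentiable (by norm_num)
    exact (h2.comp ((differentiable_const w).prodMk differentiable_id)).clm_apply
      (differentiable_const _)
  have hGh : ∀ (c : ℂ) z, G (c • z) = c ^ k * G z := by
    intro c z
    simp only [G, hline, Prod.mk_add_mk, Prod.smul_mk, smul_zero, add_zero, hz]
    exact deriv_const_mul_field _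
  suffices hG : ∃ z, z ≠ 0 ∧ G z = 0 by
    obtain ⟨z, hz0, hGz⟩ := hG
    refine ⟨z, hz0, ContinuousLinearMap.ext fun v => ?_⟩
    obtain ⟨α, β, hαβ⟩ := he v.1
    have hv : v = α • (w, (0 : Fin 2 → ℂ)) + β • (e, (0 : Fin 2 → ℂ)) +
        ((0 : Fin 2 → ℂ), v.2) := by
      refine Prod.ext ?_ ?_
      · simpa using hαβ
      · simp
    have h1 : fderiv ℂ F (w, z) (w, 0) = 0 := by
      rw [hline]
      have : (fun t : ℂ => F ((w, z) + t • (w, (0 : Fin 2 → ℂ)))) = fun _ => 0 := by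
        funext t
        have : (w, z) + t • (w, (0 : Fin 2 → ℂ)) = ((1 + t) • w, z) := by
          simp [add_smul]
        rw [this, hw, h, mul_zero]
      rw [this, deriv_const]
    have h2 : fderiv ℂ F (w, z) (0, v.2) = 0 := by
      rw [hline]
      have : (fun t : ℂ => F ((w, z) + t • ((0 : Fin 2 → ℂ), v.2))) = fun _ => 0 := by
        funext t
        simp [h]
      rw [this, deriv_const]
    rw [hv, map_add, map_add, map_smul, map_smul, h1, h2]
    change α • 0 + β • G z + 0 = 0
    simp [hGz]
  by_contra! hne
  let g : ℂ → ℂ := fun x => (G ![x, 1])⁻¹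
  have hv₁ : ∀ x : ℂ, ![x, 1] ≠ 0 := fun x hx => by simpa using congrFun hx 1
  have hv₂ : ∀ x : ℂ, ![1, x] ≠ 0 := fun x hx => by simpa using congrFun hx 0
  have hg : Differentiable ℂ g := by
    refine Differentiable.inv (hGd.comp ?_) fun x => hne _ (hv₁ x)
    refine differentiable_pi.2 fun i => ?_
    fin_cases i
    · exact differentiable_id
    · exact differentiable_const _
  have hlim : Tendsto g (cocompact ℂ) (𝓝 0) := by
    -- In the chart y = 1 / x at infinity, 1 / G(x, 1) becomes y ^ k / G(1, y); `hk` makes this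
    -- vanish at y = 0.
    have hc : ContinuousAt (fun y : ℂ => y ^ k * (G ![1, y])⁻¹) 0 := by
      refine (continuousAt_id.pow k).mul (ContinuousAt.inv₀ ?_ (hne _ (hv₂ 0)))
      refine (hGd.continuous.comp ?_).continuousAt
      refine continuous_pi fun i => ?_
      fin_cases i
      · exact continuous_const
      · exact continuous_id
    have h0 : (0 : ℂ) ^ k * (G ![1, 0])⁻¹ = 0 := by simp [hk]
    have hc' := hc.tendsto
    rw [h0] at hc'
    have h1 := hc'.comp (Filter.tendsto_inv₀_cobounded (α := ℂ))
    rw [Metric.cobounded_eq_cocompact] at h1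
    refine h1.congr' ?_
    have : ∀ᶠ x : ℂ in cocompact ℂ, x ≠ 0 := by
      rw [← Metric.cobounded_eq_cocompact]
      exact Bornology.eventually_ne_cobounded 0
    filter_upwards [this] with x hx
    have : ![x, 1] = x • ![1, x⁻¹] := by
      funext i
      fin_cases i <;> simp [hx]
    simp only [g, Function.comp, this, hGh, mul_inv, inv_pow]
  exact inv_ne_zero (hne _ (hv₁ 0)) (hg.apply_eq_of_tendsto_cocompact 0 hlim)

/-- A bihomogeneous function whose divisor is smooth does not vanish identically on a line of
either ruling. -/
structure Nondegenerate (F : C2C2 → ℂ) : Prop where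
  exists_snd : ∀ w, w ≠ 0 → ∃ z, F (w, z) ≠ 0
  exists_fst : ∀ z, z ≠ 0 → ∃ w, F (w, z) ≠ 0

lemma nondegenerate_of_fderiv_ne_zero {F : C2C2 → ℂ} (hF : ContDiff ℂ 2 F) {k : ℕ} (hk : k ≠ 0)
    (hw : ∀ (c : ℂ) w z, F (c • w, z) = c ^ k * F (w, z))
    (hz : ∀ (c : ℂ) w z, F (w, c • z) = c ^ k * F (w, z))
    (h : ∀ u : C2C2, u.1 ≠ 0 → u.2 ≠ 0 → F u = 0 → fderiv ℂ F u ≠ 0) : Nondegenerate F := by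
  constructor
  · intro w hw0
    by_contra! h0
    obtain ⟨z, hz0, hd⟩ := exists_fderiv_eq_zero hF hk hw hz hw0 h0
    exact h (w, z) hw0 hz0 (h0 z) hd
  · intro z hz0
    by_contra! h0
    let e := ContinuousLinearEquiv.prodComm ℂ (Fin 2 → ℂ) (Fin 2 → ℂ)
    obtain ⟨w, hw0, hd⟩ := exists_fderiv_eq_zero (F := F ∘ e) (hF.comp e.contDiff) hk
      (fun c w z => hz c z w) (fun c w z => hw c z w) hz0 h0
    refine h (w, z) hw0 hz0 (h0 w) ?_
    rw [e.comp_right_fderiv] at hd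
    refine ContinuousLinearMap.ext fun v => ?_
    have := congrArg (fun L => L (e.symm v)) hd
    have hv : e (e.symm v) = v := e.apply_symm_apply v
    rw [ContinuousLinearMap.comp_apply, ContinuousLinearEquiv.coe_coe, hv] at this
    exact this

/-! ### Density of non-roots and comparison of polynomials by multiplicities -/

open Polynomial in
lemma eq_zero_of_eval_ne_zero {G : ℂ → ℂ} (hG : Continuous G) {p : ℂ[X]} (hp : p ≠ 0)
    (h : ∀ x, p.eval x ≠ 0 → G x = 0) (x : ℂ) : G x = 0 := by
  have hd : Dense {x | p.IsRoot x}ᶜ := (finite_setOfPred_isRoot hp).countable.dense_compl ℂ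
  exact congrFun (Continuous.ext_on hd hG continuous_const fun y hy => h y hy) x

open Polynomial in
/-- Two monic polynomials of the same degree agree if `p * P' = p' * P` is solvable with
`p x ≠ 0` for every `x`. -/
lemma eq_of_mul_eq_mul {P P' : ℂ[X]} (hP : P.Monic) (hP' : P'.Monic)
    (hdeg : P.natDegree = P'.natDegree)
    (h : ∀ x, ∃ p p' : ℂ[X], p.eval x ≠ 0 ∧ p * P' = p' * P) : P = P' := by
  have hdvd : P ∣ P' := by
    rw [IsAlgClosed.dvd_iff_roots_le_roots hP.ne_zero hP'.ne_zero, Multiset.le_iff_count]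
    intro x
    obtain ⟨p, p', hp, hpp⟩ := h x
    have hp0 : p ≠ 0 := by
      rintro rfl
      simp at hp
    have hne : p' * P ≠ 0 := hpp ▸ mul_ne_zero hp0 hP'.ne_zero
    -- Since `p` does not vanish at `x`, the multiplicity in `P'` is that in `P` plus that in `p'`.
    have := congrArg (rootMultiplicity x) hpp
    rw [rootMultiplicity_mul (mul_ne_zero hp0 hP'.ne_zero), rootMultiplicity_mul hne,
      rootMultiplicity_eq_zero hp] at this
    rw [count_roots, count_roots]
    omega
  exact (eq_of_monic_of_dvd_of_natDegree_le hP hP' hdvd hdeg.ge).symm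

open Polynomial in
lemma exists_eval_eq_det {V : Type*} [AddCommGroup V] [Module ℂ V] [FiniteDimensional ℂ V]
    (f g : V →ₗ[ℂ] V) : ∃ p : ℂ[X], ∀ x, p.eval x = LinearMap.det (f + x • g) := by
  let b := Module.finBasis ℂ V
  refine ⟨((LinearMap.toMatrix b b f).map C + (X : ℂ[X]) • (LinearMap.toMatrix b b g).map C).det,
    fun x => ?_⟩
  rw [← LinearMap.det_toMatrix b, ← coe_evalRingHom, RingHom.map_det]
  congr 1
  ext i j
  simp [mul_comm x]

/-! ### Linear pencils of endomorphisms -/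

section Pencil

variable {V : Type*} [AddCommGroup V] [Module ℂ V] {V' : Type*} [AddCommGroup V'] [Module ℂ V']

/-- The determinant of `s + t T`. -/
noncomputable def pencilDet (T : V →ₗ[ℂ] V) (s t : ℂ) : ℂ :=
  LinearMap.det (s • LinearMap.id + t • T)

lemma eval_charpoly_neg_smul [FiniteDimensional ℂ V] (T : V →ₗ[ℂ] V) (s t : ℂ) :
    (LinearMap.charpoly (-t • T)).eval s = pencilDet T s t := by
  rw [LinearMap.eval_charpoly, pencilDet, neg_smul, sub_neg_eq_add]
  rfl

lemma eval_charpoly_eq_pencilDet [FiniteDimensional ℂ V] (T : V →ₗ[ℂ] V) (s : ℂ) :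
    (LinearMap.charpoly T).eval s = pencilDet T s (-1) := by
  rw [← eval_charpoly_neg_smul, neg_neg, one_smul]

lemma pencilDet_eq_smul [FiniteDimensional ℂ V] (T : V →ₗ[ℂ] V) (s : ℂ) {t : ℂ} (ht : t ≠ 0) :
    pencilDet T s t = (-t) ^ Module.finrank ℂ V * pencilDet T (-s / t) (-1) := by
  rw [pencilDet, pencilDet, ← LinearMap.det_smul, smul_add, smul_smul, smul_smul]
  congr 3
  · field_simp
  · ring_nf

/-- Homogeneity reduces `t ≠ 0` to `t = -1`, the characteristic polynomial; at `t = 0` both sides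
are a power of `s`, with equal exponents by `hV`. -/
lemma pencilDet_eq_of_charpoly_eq [FiniteDimensional ℂ V] [FiniteDimensional ℂ V']
    (hV : Module.finrank ℂ V = Module.finrank ℂ V') {T : V →ₗ[ℂ] V} {T' : V' →ₗ[ℂ] V'}
    (h : T.charpoly = T'.charpoly) (s t : ℂ) : pencilDet T s t = pencilDet T' s t := by
  by_cases ht : t = 0
  · simp [pencilDet, ht, LinearMap.det_smul, hV]
  · have h₁ := congrArg (Polynomial.eval (-s / t)) h
    rw [eval_charpoly_eq_pencilDet, eval_charpoly_eq_pencilDet, pencilDet, pencilDet] at h₁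
    rw [pencilDet_eq_smul T s ht, pencilDet_eq_smul T' s ht, pencilDet, pencilDet, h₁, hV]

lemma pencilDet_conj (e : V ≃ₗ[ℂ] V') (T : V →ₗ[ℂ] V) (T' : V' →ₗ[ℂ] V')
    (h : ∀ x, e (T x) = T' (e x)) (s t : ℂ) : pencilDet T s t = pencilDet T' s t := by
  rw [pencilDet, pencilDet, ← LinearMap.det_conj _ e]
  congr 1
  ext x
  simp [h]

open Polynomial in
-- The polynomial in the shift is monic, also when `t = 0`. Hence every point is a limit of points
-- with invertible pencil, reached by moving the scalar coordinate only.
lemma exists_shifted_charpoly [FiniteDimensional ℂ V] (T : V →ₗ[ℂ] V) (s t : ℂ) :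
    ∃ p : ℂ[X], p ≠ 0 ∧ ∀ x, p.eval x = pencilDet T (s + x) t := by
  refine ⟨(LinearMap.charpoly (-t • T)).comp (X + C s), ?_, fun x => ?_⟩
  · exact ((LinearMap.charpoly_monic _).comp_X_add_C s).ne_zero
  · rw [eval_comp, eval_add, eval_X, eval_C, eval_charpoly_neg_smul, add_comm]

/-- Functions of `z` that vanish where two pencils are invertible vanish. -/
lemma eq_zero_of_pencilDet_snd [FiniteDimensional ℂ V] [FiniteDimensional ℂ V']
    (D : V →ₗ[ℂ] V) (D' : V' →ₗ[ℂ] V') {G : (Fin 2 → ℂ) → ℂ} (hG : Continuous G)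
    (h : ∀ z, pencilDet D (z 0) (z 1) ≠ 0 → pencilDet D' (z 0) (z 1) ≠ 0 → G z = 0)
    (z : Fin 2 → ℂ) : G z = 0 := by
  obtain ⟨p, hp, hpe⟩ := exists_shifted_charpoly D (z 0) (z 1)
  obtain ⟨p', hp', hpe'⟩ := exists_shifted_charpoly D' (z 0) (z 1)
  have hc : Continuous fun x : ℂ => G (z + x • ![1, 0]) := by fun_prop
  have := eq_zero_of_eval_ne_zero hc (mul_ne_zero hp hp') (fun x hx => by
    rw [Polynomial.eval_mul, hpe, hpe'] at hx
    refine h _ ?_ ?_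
    · simpa using left_ne_zero_of_mul hx
    · simpa using right_ne_zero_of_mul hx) 0
  simpa using this

lemma eq_zero_of_pencilDet_fst [FiniteDimensional ℂ V] [FiniteDimensional ℂ V']
    (A : V →ₗ[ℂ] V) (A' : V' →ₗ[ℂ] V') {G : (Fin 2 → ℂ) → ℂ} (hG : Continuous G)
    (h : ∀ w, pencilDet A (w 1) (w 0) ≠ 0 → pencilDet A' (w 1) (w 0) ≠ 0 → G w = 0)
    (w : Fin 2 → ℂ) : G w = 0 := by
  -- The scalar coordinate of the pencil of `A` is w₁, while that of `D` is z₀; hence the swap.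
  have hc : Continuous fun z : Fin 2 → ℂ => G ![z 1, z 0] :=
    hG.comp (continuous_pi fun i => by fin_cases i <;> simp <;> fun_prop)
  have := eq_zero_of_pencilDet_snd A A' hc (fun z h₁ h₂ => h _ (by simpa using h₁)
    (by simpa using h₂)) ![w 1, w 0]
  have hw : ![w 0, w 1] = w := by
    ext i
    fin_cases i <;> rfl
  simpa [hw] using this

lemma eq_zero_of_pencilDet [FiniteDimensional ℂ V] [FiniteDimensional ℂ V']
    (A D : V →ₗ[ℂ] V) (A' D' : V' →ₗ[ℂ] V') {G : C2C2 → ℂ} (hG : Continuous G)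
    (h : ∀ u : C2C2, pencilDet A (u.1 1) (u.1 0) ≠ 0 → pencilDet A' (u.1 1) (u.1 0) ≠ 0 →
      pencilDet D (u.2 0) (u.2 1) ≠ 0 → pencilDet D' (u.2 0) (u.2 1) ≠ 0 → G u = 0)
    (u : C2C2) : G u = 0 := by
  refine eq_zero_of_pencilDet_snd D D' (G := fun z => G (u.1, z)) (by fun_prop)
    (fun z h₁ h₂ => ?_) u.2
  refine eq_zero_of_pencilDet_fst A A' (G := fun w => G (w, z)) (by fun_prop)
    (fun w h₃ h₄ => ?_) u.1
  exact h (w, z) h₃ h₄ h₁ h₂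

/-- Continuous functions that are polynomial along certain lines of both rulings. -/
structure IsPolynomialOnLines (F : C2C2 → ℂ) : Prop where
  continuous : Continuous F
  fst : ∀ z, ∃ p : Polynomial ℂ, ∀ x, p.eval x = F (![-1, x], z)
  snd : ∀ w, ∃ p : Polynomial ℂ, ∀ x, p.eval x = F (w, ![x, -1])

/-- At w = (-1, x) the pencil of `A` has determinant `A.charpoly.eval x`, and likewise for `D` at z
= (x, -1). Fixing the other variable turns `h` into a polynomial identity; nondegeneracy lets that
variable be chosen, depending on `x`, so that the factor multiplying the second characteristic
polynomial is nonzero at `x`. -/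
lemma charpoly_eq_of_mul_eq [FiniteDimensional ℂ V] [FiniteDimensional ℂ V']
    (hV : Module.finrank ℂ V = Module.finrank ℂ V')
    (A D : V →ₗ[ℂ] V) (A' D' : V' →ₗ[ℂ] V') {F F' : C2C2 → ℂ}
    (hF : IsPolynomialOnLines F) (hF' : IsPolynomialOnLines F') (hn : Nondegenerate F)
    (h : ∀ u : C2C2,
      F u * (pencilDet A' (u.1 1) (u.1 0) * pencilDet D' (u.2 0) (u.2 1)) =
        F' u * (pencilDet A (u.1 1) (u.1 0) * pencilDet D (u.2 0) (u.2 1))) :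
    A.charpoly = A'.charpoly ∧ D.charpoly = D'.charpoly := by
  have hcont := hF.continuous
  constructor
  · refine eq_of_mul_eq_mul A.charpoly_monic A'.charpoly_monic
      (by rw [A.charpoly_natDegree, A'.charpoly_natDegree, hV]) fun x => ?_
    obtain ⟨z, hz, hz'⟩ : ∃ z : Fin 2 → ℂ, pencilDet D' (z 0) (z 1) ≠ 0 ∧
        F (![-1, x], z) ≠ 0 := by
      by_contra! hcon
      obtain ⟨z, hz⟩ := hn.exists_snd ![-1, x] (fun h0 => by simpa using congrFun h0 0)
      -- If `F` vanished wherever the pencil of `D'` is invertible, then by density it would vanish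
      -- on the whole line.
      exact hz (eq_zero_of_pencilDet_snd D' D' (G := fun z => F (![-1, x], z)) (by fun_prop)
        (fun z h₁ _ => hcon z h₁) z)
    obtain ⟨p, hp⟩ := hF.fst z
    obtain ⟨p', hp'⟩ := hF'.fst z
    refine ⟨p * Polynomial.C (pencilDet D' (z 0) (z 1)),
      p' * Polynomial.C (pencilDet D (z 0) (z 1)), ?_, Polynomial.funext fun y => ?_⟩
    · rw [Polynomial.eval_mul, Polynomial.eval_C, hp]
      exact mul_ne_zero hz' hz
    · simp only [Polynomial.eval_mul, Polynomial.eval_C, hp, hp', eval_charpoly_eq_pencilDet]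
      have := h (![-1, y], z)
      simp only [Matrix.cons_val_zero, Matrix.cons_val_one] at this
      linear_combination this
  · refine eq_of_mul_eq_mul D.charpoly_monic D'.charpoly_monic
      (by rw [D.charpoly_natDegree, D'.charpoly_natDegree, hV]) fun x => ?_
    obtain ⟨w, hw, hw'⟩ : ∃ w : Fin 2 → ℂ, pencilDet A' (w 1) (w 0) ≠ 0 ∧
        F (w, ![x, -1]) ≠ 0 := by
      by_contra! hcon
      obtain ⟨w, hw⟩ := hn.exists_fst ![x, -1] (fun h0 => by simpa using congrFun h0 1)
      exact hw (eq_zero_of_pencilDet_fst A' A' (G := fun w => F (w, ![x, -1])) (by fun_prop)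
        (fun w h₁ _ => hcon w h₁) w)
    obtain ⟨p, hp⟩ := hF.snd w
    obtain ⟨p', hp'⟩ := hF'.snd w
    refine ⟨p * Polynomial.C (pencilDet A' (w 1) (w 0)),
      p' * Polynomial.C (pencilDet A (w 1) (w 0)), ?_, Polynomial.funext fun y => ?_⟩
    · rw [Polynomial.eval_mul, Polynomial.eval_C, hp]
      exact mul_ne_zero hw' hw
    · simp only [Polynomial.eval_mul, Polynomial.eval_C, hp, hp', eval_charpoly_eq_pencilDet]
      have := h (w, ![y, -1])
      simp only [Matrix.cons_val_zero, Matrix.cons_val_one] at this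
      linear_combination this

lemma eq_of_mul_pencilDet_eq [FiniteDimensional ℂ V] [FiniteDimensional ℂ V']
    (A D : V →ₗ[ℂ] V) (A' D' : V' →ₗ[ℂ] V') {F F' : C2C2 → ℂ}
    (hF : Continuous F) (hF' : Continuous F')
    (hA : ∀ s t, pencilDet A s t = pencilDet A' s t)
    (hD : ∀ s t, pencilDet D s t = pencilDet D' s t)
    (h : ∀ u : C2C2,
      F u * (pencilDet A' (u.1 1) (u.1 0) * pencilDet D' (u.2 0) (u.2 1)) =
        F' u * (pencilDet A (u.1 1) (u.1 0) * pencilDet D (u.2 0) (u.2 1))) : F = F' := by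
  funext u
  refine sub_eq_zero.1 (eq_zero_of_pencilDet A D A' D' (G := fun u => F u - F' u) (by fun_prop)
    (fun u h₁ h₂ h₃ h₄ => ?_) u)
  have := h u
  rw [hA, hD] at this
  exact sub_eq_zero.2 (mul_right_cancel₀ (mul_ne_zero h₂ h₄) this)

end Pencil

/-- The determinants of `a d + c P⁻ P⁺` and `d' a' + c P⁺ P⁻` for intertwining `P⁺` and `P⁻`. -/
lemma det_mul_eq_det_mul {ι : Type*} [Fintype ι] [DecidableEq ι]
    {a d a' d' P R : Matrix ι ι ℂ} (c : ℂ) (hR : R * a' = a * R) (hP : P * d = d' * P)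
    (ha : a.det ≠ 0) (hd : d.det ≠ 0) :
    (a * d + c • (R * P)).det * (a'.det * d'.det) =
      (d' * a' + c • (P * R)).det * (a.det * d.det) := by
  have ha' := (isUnit_iff_ne_zero.2 ha)
  have hd' := (isUnit_iff_ne_zero.2 hd)
  -- With X = a⁻¹R and Y = cPd⁻¹ the two matrices are a(1 + XY)d and d'(1 + YX)a'; the intertwining
  -- relations let the same X and Y serve both.
  have h₁ : a * d + c • (R * P) = a * (1 + (a⁻¹ * R) * (c • (P * d⁻¹))) * d := by
    have e₁ : a * (a⁻¹ * R) = R := Matrix.mul_nonsing_inv_cancel_left a R ha'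
    have e₂ : P * d⁻¹ * d = P := Matrix.nonsing_inv_mul_cancel_right d P hd'
    rw [mul_add, mul_one, add_mul, ← mul_assoc a, e₁, mul_assoc R, Matrix.smul_mul, e₂,
      Matrix.mul_smul]
  have h₂ : d' * a' + c • (P * R) = d' * (1 + (c • (P * d⁻¹)) * (a⁻¹ * R)) * a' := by
    have e₁ : a⁻¹ * R * a' = R := by
      rw [mul_assoc, hR, Matrix.nonsing_inv_mul_cancel_left a R ha']
    have e₂ : d' * (P * d⁻¹) = P := by
      rw [← mul_assoc, ← hP, Matrix.mul_nonsing_inv_cancel_right d P hd']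
    rw [mul_add, mul_one, add_mul, Matrix.smul_mul, Matrix.mul_smul, Matrix.smul_mul,
      ← mul_assoc d', e₂, mul_assoc P, e₁]
  rw [h₁, h₂, Matrix.det_mul, Matrix.det_mul, Matrix.det_mul, Matrix.det_mul,
    Matrix.det_one_add_mul_comm]
  ring

/-! ### The matrix `M_r`, its determinant and its corank -/

namespace DNData

open Module

variable {V : ℤ → Type u} [∀ r, AddCommGroup (V r)] [∀ r, Module ℂ (V r)]

lemma M_fst_smul (N : DNData V) (r : ℤ) (c : ℂ) (w z : Fin 2 → ℂ) :
    N.M r (c • w, z) = c • N.M r (w, z) := by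
  simp only [M, Pi.smul_apply, smul_eq_mul, smul_add, smul_smul, mul_assoc]

lemma M_snd_smul (N : DNData V) (r : ℤ) (c : ℂ) (w z : Fin 2 → ℂ) :
    N.M r (w, c • z) = c • N.M r (w, z) := by
  simp only [M, Pi.smul_apply, smul_eq_mul, smul_add, smul_smul, mul_left_comm _ c]

lemma range_M_eq (N : DNData V) (r : ℤ) {u u' : C2C2} {p : Q} (h : IsLift u p)
    (h' : IsLift u' p) : LinearMap.range (N.M r u') = LinearMap.range (N.M r u) := by
  obtain ⟨c, d, hc, hd, h₁, h₂⟩ := h.exists_smul h'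
  have : N.M r u' = c • d • N.M r u := by
    rw [← Prod.mk.eta (p := u'), h₁, h₂, M_fst_smul, M_snd_smul]
  rw [this, LinearMap.range_smul _ _ hc, LinearMap.range_smul _ _ hd]

lemma exists_notMem_range_M (N : DNData V) (r : ℤ) {S : Set Q}
    (hS : ∀ q ∈ S, finrank ℂ (V r ⧸ LinearMap.range (N.M r (rep q))) = 1) (p : S) :
    ∃ v₀ : V r, v₀ ∉ LinearMap.range (N.M r (rep p.1)) := by
  by_contra! hcon
  have h1 := hS _ p.2
  have htop : LinearMap.range (N.M r (rep p.1)) = ⊤ := eq_top_iff.2 fun v _ => hcon v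
  rw [htop] at h1
  have h0 : finrank ℂ (V r ⧸ (⊤ : Submodule ℂ (V r))) = 0 := finrank_zero_of_subsingleton
  omega

lemma toMatrix_M {ι : Type*} [Fintype ι] [DecidableEq ι] (N : DNData V) (r : ℤ)
    (b : Basis ι ℂ (V r)) (u : C2C2) (i j : ι) :
    LinearMap.toMatrix b b (N.M r u) i j =
      u.1 0 * u.2 0 * LinearMap.toMatrix b b (N.A r) i j +
      u.1 0 * u.2 1 * LinearMap.toMatrix b b (N.B r) i j +
      u.1 1 * u.2 0 * (1 : Matrix ι ι ℂ) i j +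
      u.1 1 * u.2 1 * LinearMap.toMatrix b b (N.D r) i j := by
  simp [M]

lemma contDiff_toMatrix_M {ι : Type*} [Fintype ι] [DecidableEq ι] (N : DNData V) (r : ℤ)
    (b : Basis ι ℂ (V r)) {n : WithTop ℕ∞} (i j : ι) :
    ContDiff ℂ n fun u : C2C2 => LinearMap.toMatrix b b (N.M r u) i j := by
  simp only [toMatrix_M]
  fun_prop

section FiniteDimensional

variable [∀ r, FiniteDimensional ℂ (V r)]

lemma contDiff_spectralDet (N : DNData V) (r : ℤ) {n : WithTop ℕ∞} :
    ContDiff ℂ n (N.spectralDet r) := by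
  have : N.spectralDet r = fun u =>
      (LinearMap.toMatrix (finBasis ℂ (V r)) (finBasis ℂ (V r)) (N.M r u)).det :=
    funext fun u => (LinearMap.det_toMatrix _ _).symm
  rw [this]
  exact contDiff_det fun i j => N.contDiff_toMatrix_M r _ i j

lemma spectralDet_fst_smul (N : DNData V) (r : ℤ) (c : ℂ) (w z : Fin 2 → ℂ) :
    N.spectralDet r (c • w, z) = c ^ finrank ℂ (V r) * N.spectralDet r (w, z) := by
  rw [spectralDet, M_fst_smul, LinearMap.det_smul]
  rfl

lemma spectralDet_snd_smul (N : DNData V) (r : ℤ) (c : ℂ) (w z : Fin 2 → ℂ) :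
    N.spectralDet r (w, c • z) = c ^ finrank ℂ (V r) * N.spectralDet r (w, z) := by
  rw [spectralDet, M_snd_smul, LinearMap.det_smul]
  rfl

lemma isPolynomialOnLines_spectralDet (N : DNData V) (r : ℤ) :
    IsPolynomialOnLines (N.spectralDet r) where
  continuous := (N.contDiff_spectralDet r (n := 0)).continuous
  fst z := by
    obtain ⟨p, hp⟩ := exists_eval_eq_det ((-z 0) • N.A r + (-z 1) • N.B r)
      (z 0 • LinearMap.id + z 1 • N.D r)
    refine ⟨p, fun x => ?_⟩
    rw [hp, spectralDet]
    congr 1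
    simp only [M, Matrix.cons_val_zero, Matrix.cons_val_one, smul_add, smul_smul]
    simp only [neg_mul, one_mul, add_assoc]
  snd w := by
    obtain ⟨p, hp⟩ := exists_eval_eq_det ((-w 0) • N.B r + (-w 1) • N.D r)
      (w 0 • N.A r + w 1 • LinearMap.id)
    refine ⟨p, fun x => ?_⟩
    rw [hp, spectralDet]
    congr 1
    simp only [M, Matrix.cons_val_zero, Matrix.cons_val_one, smul_add, smul_smul, mul_neg,
      mul_one, mul_comm x]
    abel

lemma SmoothSpectralCurve.nondegenerate {N : DNData V} {r : ℤ} (h : N.SmoothSpectralCurve r) :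
    Nondegenerate (N.spectralDet r) := by
  -- In dimension zero the determinant is the constant 1, and the argument by positive degree does
  -- not apply.
  by_cases hk : finrank ℂ (V r) = 0
  · have : ∀ u, N.spectralDet r u ≠ 0 := fun u => by
      rw [spectralDet, LinearMap.det_eq_one_of_finrank_eq_zero hk]
      exact one_ne_zero
    exact ⟨fun _ _ => ⟨0, this _⟩, fun _ _ => ⟨0, this _⟩⟩
  · exact nondegenerate_of_fderiv_ne_zero (N.contDiff_spectralDet r) hk
      (N.spectralDet_fst_smul r) (N.spectralDet_snd_smul r) h

/-- At the points of a smooth spectral curve, `M_r` has corank one. -/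
lemma SmoothSpectralCurve.finrank_quotient {N : DNData V} {r : ℤ} (h : N.SmoothSpectralCurve r)
    {u : C2C2} (h₁ : u.1 ≠ 0) (h₂ : u.2 ≠ 0) (h0 : N.spectralDet r u = 0) :
    finrank ℂ (V r ⧸ LinearMap.range (N.M r u)) = 1 := by
  have hker : finrank ℂ (V r ⧸ LinearMap.range (N.M r u)) =
      finrank ℂ (LinearMap.ker (N.M r u)) := by
    have e₁ := Submodule.finrank_quotient_add_finrank (LinearMap.range (N.M r u))
    have e₂ := LinearMap.finrank_range_add_finrank_ker (N.M r u)
    omega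
  have hpos : finrank ℂ (LinearMap.ker (N.M r u)) ≠ 0 := fun h' =>
    LinearMap.det_eq_zero_iff_ker_ne_bot.1 h0 (Submodule.finrank_eq_zero.1 h')
  rw [hker]
  by_contra hne
  have h2 : 2 ≤ finrank ℂ (LinearMap.ker (N.M r u)) := by omega
  obtain ⟨C, hC⟩ := Submodule.exists_isCompl (LinearMap.ker (N.M r u))
  -- In a basis extending one of the kernel at `u`, the matrix has two vanishing columns there, so
  -- the differential of its determinant is zero.
  let b := ((finBasis ℂ (LinearMap.ker (N.M r u))).prod (finBasis ℂ C)).map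
    (Submodule.prodEquivOfIsCompl _ _ hC)
  have hb : ∀ i, N.M r u (b (Sum.inl i)) = 0 := by
    intro i
    simp [b]
  refine h u h₁ h₂ h0 ?_
  have : N.spectralDet r = fun u => (LinearMap.toMatrix b b (N.M r u)).det :=
    funext fun u => (LinearMap.det_toMatrix _ _).symm
  rw [this]
  refine fderiv_det_eq_zero
    (fun i j => ((N.contDiff_toMatrix_M r b (n := 1) i j).differentiable one_ne_zero) u)
    (i₀ := Sum.inl ⟨0, by omega⟩) (i₁ := Sum.inl ⟨1, by omega⟩) (by simp) ?_ ?_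
  · intro i
    rw [LinearMap.toMatrix_apply, hb]
    simp
  · intro i
    rw [LinearMap.toMatrix_apply, hb]
    simp

end FiniteDimensional

/-! ### The discrete Nahm equations as factorizations -/

lemma SatisfiesDN.Pm_A {N : DNData V} {r : ℤ} (h : N.SatisfiesDN r) (x : V (r + 1)) :
    N.Pm r (N.A (r + 1) x) = N.A r (N.Pm r x) :=
  LinearMap.congr_fun (sub_eq_zero.1 h.1) x

lemma SatisfiesDN.Pp_D {N : DNData V} {r : ℤ} (h : N.SatisfiesDN r) (x : V r) :
    N.Pp r (N.D r x) = N.D (r + 1) (N.Pp r x) :=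
  LinearMap.congr_fun (sub_eq_zero.1 h.2.1) x

/-- The map `(x, x') ↦ (w₁ + w₀ A_r) x + w₀ P⁻ x'`. -/
def fstMap (N : DNData V) (r : ℤ) (w : Fin 2 → ℂ) : V r × V (r + 1) →ₗ[ℂ] V r :=
  LinearMap.coprod (w 1 • LinearMap.id + w 0 • N.A r) (w 0 • N.Pm r)

/-- The map `(x, x') ↦ z₁ P⁺ x - (z₀ + z₁ D_{r+1}) x'`. -/
def sndMap (N : DNData V) (r : ℤ) (z : Fin 2 → ℂ) : V r × V (r + 1) →ₗ[ℂ] V (r + 1) :=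
  LinearMap.coprod (z 1 • N.Pp r) (-(z 0 • LinearMap.id + z 1 • N.D (r + 1)))

/-- The map `x ↦ ((z₀ + z₁ D_r) x, z₁ P⁺ x)`. -/
def fstLift (N : DNData V) (r : ℤ) (z : Fin 2 → ℂ) : V r →ₗ[ℂ] V r × V (r + 1) :=
  LinearMap.prod (z 0 • LinearMap.id + z 1 • N.D r) (z 1 • N.Pp r)

/-- The map `x' ↦ (w₀ P⁻ x', -(w₁ + w₀ A_{r+1}) x')`. -/
def sndLift (N : DNData V) (r : ℤ) (w : Fin 2 → ℂ) : V (r + 1) →ₗ[ℂ] V r × V (r + 1) :=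
  LinearMap.prod (w 0 • N.Pm r) (-(w 1 • LinearMap.id + w 0 • N.A (r + 1)))

lemma SatisfiesDN.fstMap_fstLift {N : DNData V} {r : ℤ} (h : N.SatisfiesDN r)
    (u : C2C2) (x : V r) :
    N.fstMap r u.1 (N.fstLift r u.2 x) = N.M r u x := by
  simp only [fstMap, fstLift, M, h.2.2.1, LinearMap.coprod_apply, LinearMap.prod_apply,
    Function.prod_apply, LinearMap.add_apply, LinearMap.smul_apply, LinearMap.comp_apply,
    LinearMap.id_apply, map_add, map_smul]
  module

lemma SatisfiesDN.sndMap_sndLift {N : DNData V} {r : ℤ} (h : N.SatisfiesDN r)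
    (u : C2C2) (x : V (r + 1)) :
    N.sndMap r u.2 (N.sndLift r u.1 x) = N.M (r + 1) u x := by
  simp only [sndMap, sndLift, M, h.2.2.2, LinearMap.coprod_apply, LinearMap.prod_apply,
    Function.prod_apply, LinearMap.add_apply, LinearMap.smul_apply, LinearMap.comp_apply,
    LinearMap.id_apply, map_add, map_smul, LinearMap.neg_apply, map_neg]
  module

lemma SatisfiesDN.fstMap_sndLift {N : DNData V} {r : ℤ} (h : N.SatisfiesDN r)
    (w : Fin 2 → ℂ) (x : V (r + 1)) :
    N.fstMap r w (N.sndLift r w x) = 0 := by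
  simp only [fstMap, sndLift, LinearMap.coprod_apply, LinearMap.prod_apply,
    Function.prod_apply, LinearMap.add_apply, LinearMap.smul_apply,
    LinearMap.id_apply, map_add, map_smul, LinearMap.neg_apply, map_neg, h.Pm_A]
  module

lemma SatisfiesDN.sndMap_fstLift {N : DNData V} {r : ℤ} (h : N.SatisfiesDN r)
    (z : Fin 2 → ℂ) (x : V r) :
    N.sndMap r z (N.fstLift r z x) = 0 := by
  simp only [sndMap, fstLift, LinearMap.coprod_apply, LinearMap.prod_apply,
    Function.prod_apply, LinearMap.add_apply, LinearMap.smul_apply,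
    LinearMap.id_apply, map_add, map_smul, LinearMap.neg_apply, h.Pp_D]
  module

/-- Dividing by w_i makes the expression of degree zero, hence independent of the discontinuous
choice `rep`. -/
lemma isHolAt_fstMap (N : DNData V) (r : ℤ) {S : Set Q} {p : S} {i : Fin 2}
    (hi : (rep p.1).1 i ≠ 0) (y : V r × V (r + 1)) :
    (N.spectralBundle r S).IsHolAt (fun q => Submodule.Quotient.mk
      (((rep q.1).1 i)⁻¹ • N.fstMap r (rep q.1).1 y)) p := by
  refine ⟨3, ![fun q => (rep q.1).1 1 / (rep q.1).1 i, fun q => (rep q.1).1 0 / (rep q.1).1 i,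
    fun q => (rep q.1).1 0 / (rep q.1).1 i], ![y.1, N.A r y.1, N.Pm r y.2], ?_,
    Eventually.of_forall fun q => congrArg Submodule.Quotient.mk ?_⟩
  · intro k
    fin_cases k
    · exact holAt_fst_div 1 hi
    · exact holAt_fst_div 0 hi
    · exact holAt_fst_div 0 hi
  · simp only [fstMap, Fin.sum_univ_three, LinearMap.coprod_apply, LinearMap.add_apply,
      LinearMap.smul_apply, LinearMap.id_apply, Matrix.cons_val, div_eq_inv_mul]
    module

lemma isHolAt_sndMap (N : DNData V) (r : ℤ) {S : Set Q} {p : S} {j : Fin 2}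
    (hj : (rep p.1).2 j ≠ 0) (y : V r × V (r + 1)) :
    (N.spectralBundle (r + 1) S).IsHolAt (fun q => Submodule.Quotient.mk
      (((rep q.1).2 j)⁻¹ • N.sndMap r (rep q.1).2 y)) p := by
  refine ⟨3, ![fun q => (rep q.1).2 1 / (rep q.1).2 j, fun q => (rep q.1).2 0 / (rep q.1).2 j,
    fun q => (rep q.1).2 1 / (rep q.1).2 j], ![N.Pp r y.1, -y.2, -N.D (r + 1) y.2], ?_,
    Eventually.of_forall fun q => congrArg Submodule.Quotient.mk ?_⟩
  · intro k
    fin_cases k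
    · exact holAt_snd_div 1 hj
    · exact holAt_snd_div 0 hj
    · exact holAt_snd_div 1 hj
  · simp only [sndMap, Fin.sum_univ_three, LinearMap.coprod_apply, LinearMap.add_apply,
      LinearMap.neg_apply, LinearMap.smul_apply, LinearMap.id_apply, Matrix.cons_val,
      div_eq_inv_mul]
    module

end DNData

namespace DNData

open Module

variable {V : ℤ → Type u} [∀ r, AddCommGroup (V r)] [∀ r, Module ℂ (V r)]
  [∀ r, FiniteDimensional ℂ (V r)]

/-! ### Conservation of the spectral curve -/

/-- Where the pencils are invertible this is `det_mul_eq_det_mul` with c = w₀z₁; both sides are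
continuous and such points are dense. -/
lemma SatisfiesDN.spectralDet_mul {N : DNData V} {r : ℤ} (h : N.SatisfiesDN r)
    (hV : finrank ℂ (V r) = finrank ℂ (V (r + 1))) (u : C2C2) :
    N.spectralDet r u *
        (pencilDet (N.A (r + 1)) (u.1 1) (u.1 0) * pencilDet (N.D (r + 1)) (u.2 0) (u.2 1)) =
      N.spectralDet (r + 1) u *
        (pencilDet (N.A r) (u.1 1) (u.1 0) * pencilDet (N.D r) (u.2 0) (u.2 1)) := by
  have hpen : ∀ {W : ℤ} (T : V W →ₗ[ℂ] V W), Continuous fun x : ℂ × ℂ => pencilDet T x.1 x.2 := by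
    intro W T
    have : (fun x : ℂ × ℂ => pencilDet T x.1 x.2) = fun x => (LinearMap.toMatrix
        (finBasis ℂ (V W)) (finBasis ℂ (V W)) (x.1 • LinearMap.id + x.2 • T)).det :=
      funext fun x => (LinearMap.det_toMatrix _ _).symm
    rw [this]
    refine (contDiff_det (n := 0) fun i j => ?_).continuous
    simp only [map_add, map_smul, Matrix.add_apply, Matrix.smul_apply, smul_eq_mul]
    fun_prop
  have hF := fun s => (N.contDiff_spectralDet s (n := 0)).continuous
  have hA : ∀ {W : ℤ} (T : V W →ₗ[ℂ] V W),
      Continuous fun u : C2C2 => pencilDet T (u.1 1) (u.1 0) := fun T =>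
    (hpen T).comp (by fun_prop : Continuous fun u : C2C2 => (u.1 1, u.1 0))
  have hD : ∀ {W : ℤ} (T : V W →ₗ[ℂ] V W),
      Continuous fun u : C2C2 => pencilDet T (u.2 0) (u.2 1) := fun T =>
    (hpen T).comp (by fun_prop : Continuous fun u : C2C2 => (u.2 0, u.2 1))
  refine sub_eq_zero.1 (eq_zero_of_pencilDet (N.A r) (N.D r) (N.A (r + 1)) (N.D (r + 1))
    (((hF r).mul ((hA _).mul (hD _))).sub ((hF (r + 1)).mul ((hA _).mul (hD _)))) ?_ u)
  intro u ha _ hd _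
  refine sub_eq_zero.2 ?_
  let b := finBasis ℂ (V r)
  -- Both bases have the same index type, so `N.Pp r` and `N.Pm r` become square matrices.
  let b' := finBasisOfFinrankEq ℂ (V (r + 1)) hV.symm
  have hM : N.M r u = (u.1 1 • LinearMap.id + u.1 0 • N.A r) ∘ₗ
      (u.2 0 • LinearMap.id + u.2 1 • N.D r) + (u.1 0 * u.2 1) • (N.Pm r ∘ₗ N.Pp r) := by
    refine LinearMap.ext fun x => ?_
    simp only [M, h.2.2.1, LinearMap.add_apply, LinearMap.smul_apply, LinearMap.comp_apply,
      LinearMap.id_apply, map_add, map_smul]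
    module
  have hM' : N.M (r + 1) u = (u.2 0 • LinearMap.id + u.2 1 • N.D (r + 1)) ∘ₗ
      (u.1 1 • LinearMap.id + u.1 0 • N.A (r + 1)) +
        (u.1 0 * u.2 1) • (N.Pp r ∘ₗ N.Pm r) := by
    refine LinearMap.ext fun x => ?_
    simp only [M, h.2.2.2, LinearMap.add_apply, LinearMap.smul_apply, LinearMap.comp_apply,
      LinearMap.id_apply, map_add, map_smul]
    module
  have hR : N.Pm r ∘ₗ (u.1 1 • LinearMap.id + u.1 0 • N.A (r + 1)) =
      (u.1 1 • LinearMap.id + u.1 0 • N.A r) ∘ₗ N.Pm r := by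
    refine LinearMap.ext fun x => ?_
    simp [h.Pm_A]
  have hP : N.Pp r ∘ₗ (u.2 0 • LinearMap.id + u.2 1 • N.D r) =
      (u.2 0 • LinearMap.id + u.2 1 • N.D (r + 1)) ∘ₗ N.Pp r := by
    refine LinearMap.ext fun x => ?_
    simp [h.Pp_D]
  have hR' := congrArg (LinearMap.toMatrix b' b) hR
  have hP' := congrArg (LinearMap.toMatrix b b') hP
  rw [LinearMap.toMatrix_comp b' b' b, LinearMap.toMatrix_comp b' b b] at hR'
  rw [LinearMap.toMatrix_comp b b b', LinearMap.toMatrix_comp b b' b'] at hP'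
  have h₁ := congrArg (LinearMap.toMatrix b b) hM
  have h₂ := congrArg (LinearMap.toMatrix b' b') hM'
  rw [map_add, map_smul, LinearMap.toMatrix_comp b b b, LinearMap.toMatrix_comp b b' b] at h₁
  rw [map_add, map_smul, LinearMap.toMatrix_comp b' b' b', LinearMap.toMatrix_comp b' b b'] at h₂
  rw [pencilDet, ← LinearMap.det_toMatrix b] at ha hd
  change LinearMap.det (N.M r u) *
      (pencilDet (N.A (r + 1)) (u.1 1) (u.1 0) * pencilDet (N.D (r + 1)) (u.2 0) (u.2 1)) =
    LinearMap.det (N.M (r + 1) u) *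
      (pencilDet (N.A r) (u.1 1) (u.1 0) * pencilDet (N.D r) (u.2 0) (u.2 1))
  simp only [pencilDet]
  rw [← LinearMap.det_toMatrix b, ← LinearMap.det_toMatrix b', ← LinearMap.det_toMatrix b,
    ← LinearMap.det_toMatrix b', ← LinearMap.det_toMatrix b, ← LinearMap.det_toMatrix b', h₁, h₂]
  exact det_mul_eq_det_mul _ hR' hP' ha hd

lemma SatisfiesDN.spectralDet_eq_of_bijective {N : DNData V} {r : ℤ} (h : N.SatisfiesDN r)
    (hp : Function.Bijective (N.Pp r)) (hm : Function.Bijective (N.Pm r)) :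
    N.spectralDet r = N.spectralDet (r + 1) := by
  have hV := (LinearEquiv.ofBijective _ hp).finrank_eq
  refine eq_of_mul_pencilDet_eq (N.A r) (N.D r) (N.A (r + 1)) (N.D (r + 1))
    (N.contDiff_spectralDet r (n := 0)).continuous
    (N.contDiff_spectralDet (r + 1) (n := 0)).continuous (fun s t => ?_) (fun s t => ?_)
    (h.spectralDet_mul hV)
  · exact (pencilDet_conj (LinearEquiv.ofBijective _ hm) _ _ h.Pm_A s t).symm
  · exact pencilDet_conj (LinearEquiv.ofBijective _ hp) _ _ h.Pp_D s t

/-- The product identity is symmetric in its two ends, so nondegeneracy at either one suffices; this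
lets the conservation law spread in both directions. -/
lemma SatisfiesDN.spectralDet_eq_of_nondegenerate {N : DNData V} {r : ℤ} (h : N.SatisfiesDN r)
    (hV : finrank ℂ (V r) = finrank ℂ (V (r + 1)))
    (hn : Nondegenerate (N.spectralDet r) ∨ Nondegenerate (N.spectralDet (r + 1))) :
    N.spectralDet r = N.spectralDet (r + 1) := by
  have hmul := h.spectralDet_mul hV
  have hF := N.isPolynomialOnLines_spectralDet r
  have hF' := N.isPolynomialOnLines_spectralDet (r + 1)
  have hc : (N.A r).charpoly = (N.A (r + 1)).charpoly ∧
      (N.D r).charpoly = (N.D (r + 1)).charpoly := by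
    rcases hn with hn | hn
    · exact charpoly_eq_of_mul_eq hV _ _ _ _ hF hF' hn hmul
    · obtain ⟨h₁, h₂⟩ := charpoly_eq_of_mul_eq hV.symm _ _ _ _ hF' hF hn fun u => (hmul u).symm
      exact ⟨h₁.symm, h₂.symm⟩
  exact eq_of_mul_pencilDet_eq (N.A r) (N.D r) (N.A (r + 1)) (N.D (r + 1)) hF.continuous
    hF'.continuous (pencilDet_eq_of_charpoly_eq hV hc.1) (pencilDet_eq_of_charpoly_eq hV hc.2) hmul

/-! ### The spectral bundle is a line bundle -/

/-- Near a point where the class of `v₀` spans the cokernel of `M_r`, every vector is a multiple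
of `v₀` modulo the image of `M_r`, with analytic coefficient. -/
lemma exists_analytic_coefficient (N : DNData V) (r : ℤ) {u₀ : C2C2} {v₀ : V r}
    (h1 : finrank ℂ (V r ⧸ LinearMap.range (N.M r u₀)) = 1)
    (hv₀ : v₀ ∉ LinearMap.range (N.M r u₀)) :
    ∃ F : V r → C2C2 → ℂ, (∀ v, AnalyticAt ℂ (F v) u₀) ∧
      ∀ᶠ u in 𝓝 u₀, ∀ v, v - F v u • v₀ ∈ LinearMap.range (N.M r u) := by
  have hker : finrank ℂ (LinearMap.ker (N.M r u₀)) = 1 := by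
    have e₁ := Submodule.finrank_quotient_add_finrank (LinearMap.range (N.M r u₀))
    have e₂ := LinearMap.finrank_range_add_finrank_ker (N.M r u₀)
    omega
  obtain ⟨y, hy0, hy⟩ := finrank_eq_one_iff'.1 hker
  obtain ⟨ξ, hξ⟩ := Projective.exists_dual_eq_one ℂ
    (show (y : V r) ≠ 0 from fun h => hy0 (Subtype.ext h))
  -- With `ξ` equal to 1 on a generator of the kernel, this perturbation is invertible at `u₀`,
  -- hence nearby. Solving `T u Y = v` gives v - ξ(Y)v₀ = M_r Y, and Cramer's rule makes ξ(Y)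
  -- analytic.
  let T : C2C2 → V r →ₗ[ℂ] V r := fun u => N.M r u + ξ.smulRight v₀
  let b := finBasis ℂ (V r)
  let T' := fun u => LinearMap.toMatrix b b (T u)
  have hT' : ∀ i j, AnalyticAt ℂ (fun u => T' u i j) u₀ := by
    intro i j
    simp only [T', T, map_add, Matrix.add_apply]
    exact ((N.contDiff_toMatrix_M r b (n := ⊤) i j).contDiffAt.analyticAt).add analyticAt_const
  have hdet : AnalyticAt ℂ (fun u => (T' u).det) u₀ := analyticAt_det hT'
  have hdet0 : (T' u₀).det ≠ 0 := by
    rw [LinearMap.det_toMatrix, Ne, LinearMap.det_eq_zero_iff_ker_ne_bot, not_not,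
      LinearMap.ker_eq_bot']
    intro x hx
    have hx' : N.M r u₀ x + ξ x • v₀ = 0 := hx
    have hξx : ξ x = 0 := by
      by_contra hne
      refine hv₀ ⟨-(ξ x)⁻¹ • x, ?_⟩
      rw [map_smul, eq_neg_of_add_eq_zero_left hx', smul_neg, neg_smul, neg_neg, smul_smul,
        inv_mul_cancel₀ hne, one_smul]
    rw [hξx, zero_smul, add_zero] at hx'
    obtain ⟨c, hc⟩ := hy ⟨x, hx'⟩
    have hc' : c • (y : V r) = x := congrArg Subtype.val hc
    rw [← hc', map_smul, hξ, smul_eq_mul, mul_one] at hξx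
    rw [← hc', hξx, zero_smul]
  refine ⟨fun v u => ∑ i, ((T' u).det⁻¹ * ((T' u).updateCol i (b.repr v)).det) * ξ (b i),
    fun v => ?_, ?_⟩
  · refine Finset.analyticAt_fun_sum _ fun i _ => ((hdet.inv hdet0).mul ?_).mul analyticAt_const
    refine analyticAt_det fun k l => ?_
    simp only [Matrix.updateCol_apply]
    split_ifs
    · exact analyticAt_const
    · exact hT' k l
  · filter_upwards [hdet.continuousAt.eventually_ne hdet0] with u hu v
    let Y : V r := b.equivFun.symm ((T' u).det⁻¹ • (T' u).cramer (b.repr v))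
    have hTY : T u Y = v := by
      apply b.equivFun.injective
      change ⇑(b.repr (T u Y)) = b.repr v
      rw [← LinearMap.toMatrix_mulVec_repr b b]
      change (T' u).mulVec (b.equivFun Y) = b.repr v
      rw [LinearEquiv.apply_symm_apply, Matrix.mulVec_smul, Matrix.mulVec_cramer, smul_smul,
        inv_mul_cancel₀ hu, one_smul]
    have hξY : ξ Y = ∑ i, ((T' u).det⁻¹ * ((T' u).updateCol i (b.repr v)).det) * ξ (b i) := by
      simp only [Y, Basis.equivFun_symm_apply, map_sum, map_smul, smul_eq_mul,
        Matrix.cramer_apply, Finset.mul_sum, mul_assoc]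
    refine ⟨Y, ?_⟩
    rw [← hξY]
    exact eq_sub_of_add_eq hTY

lemma isFrameAt_spectralBundle (N : DNData V) (r : ℤ) {S : Set Q}
    (hS : ∀ q ∈ S, finrank ℂ (V r ⧸ LinearMap.range (N.M r (rep q))) = 1) (p : S) {v₀ : V r}
    (hv₀ : v₀ ∉ LinearMap.range (N.M r (rep p.1))) :
    (N.spectralBundle r S).IsFrameAt (fun _ => Submodule.Quotient.mk v₀) p ∧
      ∀ᶠ q : S in 𝓝 p, v₀ ∉ LinearMap.range (N.M r (rep q.1)) := by
  have hcoef : ∀ u₀ : Lift p.1, ∃ F : V r → C2C2 → ℂ, (∀ v, AnalyticAt ℂ (F v) u₀.1) ∧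
      ∀ᶠ u in 𝓝 u₀.1, ∀ q : S, IsLift u q.1 → v₀ ∉ LinearMap.range (N.M r (rep q.1)) ∧
        ∀ v, v - F v u • v₀ ∈ LinearMap.range (N.M r (rep q.1)) := by
    intro u₀
    have hr := N.range_M_eq r (isLift_rep p.1) u₀.2
    obtain ⟨F, hF, h⟩ := N.exists_analytic_coefficient r (u₀ := u₀.1) (v₀ := v₀)
      (by rw [hr]; exact hS _ p.2) (by rwa [hr])
    refine ⟨F, hF, ?_⟩
    filter_upwards [h] with u hu q hq
    rw [← N.range_M_eq r hq (isLift_rep q.1)] at hu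
    refine ⟨fun hmem => ?_, hu⟩
    -- If `v₀` lay in the image at `q`, so would every vector, against corank one.
    have htop : LinearMap.range (N.M r (rep q.1)) = ⊤ := by
      refine eq_top_iff.2 fun v _ => ?_
      have := Submodule.add_mem _ (hu v) (Submodule.smul_mem _ (F v u) hmem)
      rwa [sub_add_cancel] at this
    have h1 := hS _ q.2
    rw [htop] at h1
    have h0 : finrank ℂ (V r ⧸ (⊤ : Submodule ℂ (V r))) = 0 :=
      finrank_zero_of_subsingleton
    omega
  have hev : ∀ᶠ q : S in 𝓝 p, v₀ ∉ LinearMap.range (N.M r (rep q.1)) := by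
    obtain ⟨F, -, h⟩ := hcoef ⟨_, isLift_rep p.1⟩
    rw [eventually_iff_lift (isLift_rep p.1)]
    exact h.mono fun u hu q hq => (hu q hq).1
  refine ⟨?_, hev⟩
  have hex : ∀ v, ∃ f : S → ℂ, ∀ q : S, v₀ ∉ LinearMap.range (N.M r (rep q.1)) →
      v - f q • v₀ ∈ LinearMap.range (N.M r (rep q.1)) := by
    intro v
    have : ∀ q : S, ∃ c : ℂ, v₀ ∉ LinearMap.range (N.M r (rep q.1)) →
        v - c • v₀ ∈ LinearMap.range (N.M r (rep q.1)) := by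
      intro q
      by_cases hq : v₀ ∈ LinearMap.range (N.M r (rep q.1))
      · exact ⟨0, fun h => (h hq).elim⟩
      · obtain ⟨c, hc⟩ := (finrank_eq_one_iff_of_nonzero'
          (Submodule.Quotient.mk v₀ : V r ⧸ LinearMap.range (N.M r (rep q.1)))
          (fun h => hq ((Submodule.Quotient.mk_eq_zero _).1 h))).1 (hS _ q.2)
          (Submodule.Quotient.mk v)
        refine ⟨c, fun _ => (Submodule.Quotient.mk_eq_zero _).1 ?_⟩
        rw [Submodule.Quotient.mk_sub, Submodule.Quotient.mk_smul, hc, sub_self]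
    choose f hf using this
    exact ⟨f, hf⟩
  choose f hf using hex
  have hhol : ∀ v, HolAt (f v) p := by
    intro v u₀
    obtain ⟨F, hF, h⟩ := hcoef u₀
    refine ⟨F v, hF v, ?_⟩
    filter_upwards [h] with u hu q hq
    obtain ⟨hq₁, hq₂⟩ := hu q hq
    -- The coefficient of `v₀` modulo the image is unique where `v₀` is not in it, so the pointwise
    -- choice agrees with the analytic one.
    have hsub := Submodule.sub_mem _ (hq₂ v) (hf v q hq₁)
    rw [sub_sub_sub_cancel_left, ← sub_smul] at hsub
    by_contra hne
    exact hq₁ ((Submodule.smul_mem_iff _ (sub_ne_zero.2 hne)).1 hsub)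
  intro s
  constructor
  · rintro ⟨n, g, v, hg, hs⟩
    refine ⟨fun q => ∑ i, g i q * f (v i) q, holAt_sum _ fun i _ => (hg i).mul (hhol _), ?_⟩
    filter_upwards [hs, hev] with q h₁ h₂
    rw [h₁]
    change (Submodule.Quotient.mk _ : V r ⧸ LinearMap.range (N.M r (rep q.1))) =
      Submodule.Quotient.mk ((∑ i, g i q * f (v i) q) • v₀)
    rw [Submodule.Quotient.eq, Finset.sum_smul,
      ← Finset.sum_sub_distrib]
    refine Submodule.sum_mem _ fun i _ => ?_
    rw [mul_smul, ← smul_sub]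
    exact Submodule.smul_mem _ _ (hf _ q h₂)
  · rintro ⟨g, hg, hs⟩
    refine ⟨1, fun _ => g, fun _ => v₀, fun _ => hg, ?_⟩
    filter_upwards [hs] with q hq
    rw [hq, Fin.sum_univ_one, Submodule.Quotient.mk_smul]
    rfl

lemma hasFrames_spectralBundle (N : DNData V) (r : ℤ) {S : Set Q}
    (hS : ∀ q ∈ S, finrank ℂ (V r ⧸ LinearMap.range (N.M r (rep q))) = 1) :
    (N.spectralBundle r S).HasFrames := by
  intro p
  obtain ⟨v₀, hv₀⟩ := N.exists_notMem_range_M r hS p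
  exact ⟨_, (N.isFrameAt_spectralBundle r hS p hv₀).1⟩

lemma isHolomorphicLineBundle_spectralBundle (N : DNData V) (r : ℤ) {S : Set Q}
    (hS : ∀ q ∈ S, finrank ℂ (V r ⧸ LinearMap.range (N.M r (rep q))) = 1) :
    (N.spectralBundle r S).IsHolomorphicLineBundle := by
  refine ⟨fun p => hS _ p.2, fun p => ?_⟩
  obtain ⟨v₀, hv₀⟩ := N.exists_notMem_range_M r hS p
  refine ⟨fun _ => Submodule.Quotient.mk v₀, ?_⟩
  filter_upwards [(N.isFrameAt_spectralBundle r hS p hv₀).2] with q hq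
  exact ⟨fun h => hq ((Submodule.Quotient.mk_eq_zero _).1 h),
    (N.isFrameAt_spectralBundle r hS q hq).1⟩

end DNData

/-! ### Comparing quotients, and induction over consecutive integers -/

/-- Two surjections with nested kernels onto spaces of the same dimension differ by an
isomorphism. -/
lemma exists_linearEquiv_of_ker_le {X Y Z : Type*} [AddCommGroup X] [Module ℂ X]
    [AddCommGroup Y] [Module ℂ Y] [FiniteDimensional ℂ Y] [AddCommGroup Z] [Module ℂ Z]
    [FiniteDimensional ℂ Z] (f : X →ₗ[ℂ] Y) (g : X →ₗ[ℂ] Z) (hf : Function.Surjective f)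
    (hg : Function.Surjective g) (hker : LinearMap.ker f ≤ LinearMap.ker g)
    (hd : Module.finrank ℂ Y = Module.finrank ℂ Z) : ∃ θ : Y ≃ₗ[ℂ] Z, ∀ x, θ (f x) = g x := by
  let t : Y →ₗ[ℂ] Z :=
    (LinearMap.ker f).liftQ g hker ∘ₗ (f.quotKerEquivOfSurjective hf).symm.toLinearMap
  have ht : ∀ x, t (f x) = g x := by
    intro x
    have : (f.quotKerEquivOfSurjective hf).symm (f x) = Submodule.Quotient.mk x := by
      rw [LinearEquiv.symm_apply_eq]
      rfl
    simp only [t, LinearMap.comp_apply, LinearEquiv.coe_coe, this]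
    rfl
  have hs : Function.Surjective t := fun z =>
    let ⟨x, hx⟩ := hg z
    ⟨f x, (ht x).trans hx⟩
  exact ⟨LinearEquiv.ofBijective t
    ⟨(LinearMap.injective_iff_surjective_of_finrank_eq_finrank hd).2 hs, hs⟩, ht⟩

/-- A property that propagates between adjacent points propagates over a set of consecutive
integers. -/
lemma forall_mem_of_adjacent {Z : Set ℤ} (hZ : Z.OrdConnected) {P : ℤ → Prop}
    (h : ∀ r, r ∈ Z → r + 1 ∈ Z → (P r ↔ P (r + 1))) {r₀ : ℤ} (h₀ : r₀ ∈ Z) (hP : P r₀)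
    {r : ℤ} (hr : r ∈ Z) : P r := by
  rcases le_total r₀ r with hle | hle
  · suffices ∀ s, r₀ ≤ s → s ≤ r → P s from this r hle le_rfl
    intro s hs
    induction s, hs using Int.leInduction with
    | base => exact fun _ => hP
    | succ s hs ih =>
      intro hsr
      exact (h s (hZ.out h₀ hr ⟨hs, by omega⟩) (hZ.out h₀ hr ⟨by omega, hsr⟩)).1 (ih (by omega))
  · suffices ∀ s, s ≤ r₀ → r ≤ s → P s from this r hle le_rfl
    intro s hs
    induction s, hs using Int.leInductionDown with
    | base => exact fun _ => hP
    | pred s hs ih =>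
      intro hsr
      have := h (s - 1) (hZ.out hr h₀ ⟨hsr, by omega⟩)
      rw [sub_add_cancel] at this
      exact (this (hZ.out hr h₀ ⟨by omega, hs⟩)).2 (ih (by omega))

/-! ### One step of the evolution -/

namespace DNData

open Module

variable {V : ℤ → Type u} [∀ r, AddCommGroup (V r)] [∀ r, Module ℂ (V r)]
  [∀ r, FiniteDimensional ℂ (V r)]

lemma bijective_M (N : DNData V) (r : ℤ) {u : C2C2} (h : N.spectralDet r u ≠ 0) :
    Function.Bijective (N.M r u) := by
  have hi : Function.Injective (N.M r u) := by
    rw [← LinearMap.ker_eq_bot]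
    by_contra hk
    exact h (LinearMap.det_eq_zero_iff_ker_ne_bot.2 hk)
  exact ⟨hi, LinearMap.injective_iff_surjective.1 hi⟩

/-- M_r(w, z) factors through this map for every z, and is invertible for some z by nondegeneracy.
-/
lemma SatisfiesDN.fstMap_surjective {N : DNData V} {r : ℤ} (h : N.SatisfiesDN r)
    (hn : Nondegenerate (N.spectralDet r)) {w : Fin 2 → ℂ} (hw : w ≠ 0) :
    Function.Surjective (N.fstMap r w) := by
  intro y
  obtain ⟨z, hz⟩ := hn.exists_snd w hw
  obtain ⟨x, hx⟩ := (N.bijective_M r hz).2 y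
  exact ⟨_, (h.fstMap_fstLift (w, z) x).trans hx⟩

lemma SatisfiesDN.sndMap_surjective {N : DNData V} {r : ℤ} (h : N.SatisfiesDN r)
    (hn : Nondegenerate (N.spectralDet (r + 1))) {z : Fin 2 → ℂ} (hz : z ≠ 0) :
    Function.Surjective (N.sndMap r z) := by
  intro y
  obtain ⟨w, hw⟩ := hn.exists_fst z hz
  obtain ⟨x, hx⟩ := (N.bijective_M (r + 1) hw).2 y
  exact ⟨_, (h.sndMap_sndLift (w, z) x).trans hx⟩

/-- The kernel of `(x, x') ↦ (w₁ + w₀ A_r) x + w₀ P⁻ x'`. -/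
lemma SatisfiesDN.ker_fstMap {N : DNData V} {r : ℤ} (h : N.SatisfiesDN r)
    (hV : finrank ℂ (V r) = finrank ℂ (V (r + 1))) (hn : Nondegenerate (N.spectralDet r))
    (hn' : Nondegenerate (N.spectralDet (r + 1))) {w : Fin 2 → ℂ} (hw : w ≠ 0) :
    LinearMap.ker (N.fstMap r w) = LinearMap.range (N.sndLift r w) := by
  -- For a suitable z, following by `sndMap` gives the invertible M_{r+1}(w, z).
  have hinj : Function.Injective (N.sndLift r w) := by
    intro x y hxy
    obtain ⟨z, hz⟩ := hn'.exists_snd w hw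
    apply (N.bijective_M (r + 1) hz).1
    rw [← h.sndMap_sndLift (w, z), ← h.sndMap_sndLift (w, z), hxy]
  refine (Submodule.eq_of_le_of_finrank_eq ?_ ?_).symm
  · rintro _ ⟨x, rfl⟩
    exact h.fstMap_sndLift w x
  · have e₁ := LinearMap.finrank_range_add_finrank_ker (N.fstMap r w)
    rw [LinearMap.range_eq_top.2 (h.fstMap_surjective hn hw), finrank_top, finrank_prod,
      hV] at e₁
    rw [LinearMap.finrank_range_of_inj hinj]
    omega

/-- The cokernels of `M_r` and `M_{r+1}` at a point are isomorphic. -/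
lemma SatisfiesDN.exists_cokernel_equiv {N : DNData V} {r : ℤ} (h : N.SatisfiesDN r)
    (hV : finrank ℂ (V r) = finrank ℂ (V (r + 1))) (hn : Nondegenerate (N.spectralDet r))
    (hn' : Nondegenerate (N.spectralDet (r + 1))) {u : C2C2} (h₁ : u.1 ≠ 0) (h₂ : u.2 ≠ 0)
    (hd : finrank ℂ (V r ⧸ LinearMap.range (N.M r u)) =
      finrank ℂ (V (r + 1) ⧸ LinearMap.range (N.M (r + 1) u))) :
    ∃ θ : (V r ⧸ LinearMap.range (N.M r u)) ≃ₗ[ℂ] V (r + 1) ⧸ LinearMap.range (N.M (r + 1) u),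
      ∀ y, θ (Submodule.Quotient.mk (N.fstMap r u.1 y)) =
        Submodule.Quotient.mk (N.sndMap r u.2 y) := by
  refine exists_linearEquiv_of_ker_le
    ((LinearMap.range (N.M r u)).mkQ ∘ₗ N.fstMap r u.1)
    ((LinearMap.range (N.M (r + 1) u)).mkQ ∘ₗ N.sndMap r u.2)
    ((Submodule.mkQ_surjective _).comp (h.fstMap_surjective hn h₁))
    ((Submodule.mkQ_surjective _).comp (h.sndMap_surjective hn' h₂)) ?_ hd
  intro y hy
  -- If `fstMap` sends `y` to M_r x, then `y` is the `fstLift` of `x` plus the `sndLift` of some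
  -- `x'`; applying `sndMap` leaves M_{r+1} x'.
  obtain ⟨x, hx⟩ := (Submodule.Quotient.mk_eq_zero _).1 (LinearMap.mem_ker.1 hy)
  have hmem : y - N.fstLift r u.2 x ∈ LinearMap.ker (N.fstMap r u.1) := by
    rw [LinearMap.mem_ker, map_sub, h.fstMap_fstLift, hx, sub_self]
  rw [h.ker_fstMap hV hn hn' h₁] at hmem
  obtain ⟨x', hx'⟩ := hmem
  refine LinearMap.mem_ker.2 ((Submodule.Quotient.mk_eq_zero _).2 ⟨x', ?_⟩)
  rw [← h.sndMap_sndLift, hx', map_sub, h.sndMap_fstLift, sub_zero]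

/-- Evaluation at the representative coordinates, as an isomorphism from the fibre of
`𝒪(1, -1)`. -/
lemma exists_evaluation_equiv (q : Q) :
    ∃ ev : PreBundle.twistFiber 1 (-1) q ≃ₗ[ℂ] ℂ, ∀ h, ev h = h.1 ⟨rep q, isLift_rep q⟩ := by
  let ev : PreBundle.twistFiber 1 (-1) q →ₗ[ℂ] ℂ :=
    { toFun := fun h => h.1 ⟨rep q, isLift_rep q⟩
      map_add' := fun _ _ => rfl
      map_smul' := fun _ _ => rfl }
  obtain ⟨i, hi⟩ := PreBundle.exists_rep_fst_ne q
  obtain ⟨j, hj⟩ := PreBundle.exists_rep_snd_ne q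
  have hinj : Function.Injective ev := by
    rw [injective_iff_map_eq_zero]
    intro h h0
    have h0' : h.1 ⟨rep q, isLift_rep q⟩ = 0 := h0
    rw [PreBundle.twistFiber_eq_smul h ⟨rep q, isLift_rep q⟩ hi hj, h0', zero_mul, zero_smul]
  have : FiniteDimensional ℂ (PreBundle.twistFiber 1 (-1) q) :=
    finite_of_finrank_eq_succ (PreBundle.finrank_twistFiber q)
  have hd : finrank ℂ (PreBundle.twistFiber 1 (-1) q) = finrank ℂ ℂ := by
    rw [PreBundle.finrank_twistFiber, finrank_self]
  exact ⟨LinearEquiv.ofBijective ev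
    ⟨hinj, (LinearMap.injective_iff_surjective_of_finrank_eq_finrank hd).1 hinj⟩, fun _ => rfl⟩

/-- One step of the evolution is tensoring with `𝒪(1, -1)`. -/
lemma SatisfiesDN.isIsomorphic_succ {N : DNData V} {r : ℤ} (h : N.SatisfiesDN r)
    (hV : finrank ℂ (V r) = finrank ℂ (V (r + 1))) (hn : Nondegenerate (N.spectralDet r))
    (hn' : Nondegenerate (N.spectralDet (r + 1))) {S : Set Q}
    (hS : ∀ q ∈ S, finrank ℂ (V r ⧸ LinearMap.range (N.M r (rep q))) = 1)
    (hS' : ∀ q ∈ S, finrank ℂ (V (r + 1) ⧸ LinearMap.range (N.M (r + 1) (rep q))) = 1) :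
    (N.spectralBundle (r + 1) S).IsIsomorphic
      ((N.spectralBundle r S).tensor (PreBundle.O S 1 (-1))) := by
  have hθ := fun q : S => h.exists_cokernel_equiv hV hn hn' (u := rep q.1) q.1.1.rep_nonzero
    q.1.2.rep_nonzero ((hS q q.2).trans (hS' q q.2).symm)
  choose θ hθ using hθ
  choose ev hev using exists_evaluation_equiv
  let φ : ∀ q : S, ((N.spectralBundle r S).tensor (PreBundle.O S 1 (-1))).fiber q ≃ₗ[ℂ]
      (N.spectralBundle (r + 1) S).fiber q := fun q =>
    (TensorProduct.congr (θ q) (ev q.1)).trans (TensorProduct.rid ℂ _)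
  have hφ : ∀ (q : S) (m : V r ⧸ LinearMap.range (N.M r (rep q.1)))
      (t : PreBundle.twistFiber 1 (-1) q.1),
      φ q (m ⊗ₜ[ℂ] t) = t.1 ⟨rep q.1, isLift_rep q.1⟩ • θ q m := by
    intro q m t
    rw [← hev]
    rfl
  refine (PreBundle.isIsomorphic_of_frames φ fun p => ?_).symm
  obtain ⟨i, hi⟩ := PreBundle.exists_rep_fst_ne p.1
  obtain ⟨j, hj⟩ := PreBundle.exists_rep_snd_ne p.1
  obtain ⟨v, hv⟩ := N.exists_notMem_range_M r hS p
  obtain ⟨y, rfl⟩ := h.fstMap_surjective hn p.1.1.rep_nonzero v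
  have hne : (Submodule.Quotient.mk (N.fstMap r (rep p.1).1 y) :
      V r ⧸ LinearMap.range (N.M r (rep p.1))) ≠ 0 := fun h0 =>
    hv ((Submodule.Quotient.mk_eq_zero _).1 h0)
  have he : (N.spectralBundle r S).IsFrameAt (fun q => Submodule.Quotient.mk
      (((rep q.1).1 i)⁻¹ • N.fstMap r (rep q.1).1 y)) p := by
    refine (N.isFrameAt_spectralBundle r hS p hv).1.of_ne_zero (N.isHolAt_fstMap r hi y) ?_
    exact smul_ne_zero (inv_ne_zero hi) hne
  refine ⟨_, he.tensor (PreBundle.isFrameAt_coordRatio hi hj), ?_⟩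
  -- The factors w_i cancel: (`fstMap` y / w_i) ⊗ (w_i / z_j) goes to `sndMap` y / z_j, again of
  -- degree zero and holomorphic.
  have hval : ∀ q : S, (rep q.1).1 i ≠ 0 → φ q ((Submodule.Quotient.mk
      (((rep q.1).1 i)⁻¹ • N.fstMap r (rep q.1).1 y) :
        V r ⧸ LinearMap.range (N.M r (rep q.1))) ⊗ₜ[ℂ] PreBundle.coordRatio i j q.1) =
      (Submodule.Quotient.mk (((rep q.1).2 j)⁻¹ • N.sndMap r (rep q.1).2 y) :
        V (r + 1) ⧸ LinearMap.range (N.M (r + 1) (rep q.1))) := by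
    intro q hq
    rw [hφ, Submodule.Quotient.mk_smul, map_smul, hθ, smul_smul, Submodule.Quotient.mk_smul]
    congr 1
    change (rep q.1).1 i / (rep q.1).2 j * ((rep q.1).1 i)⁻¹ = _
    field_simp
  obtain ⟨v', hv'⟩ := N.exists_notMem_range_M (r + 1) hS' p
  refine (N.isFrameAt_spectralBundle (r + 1) hS' p hv').1.of_ne_zero ?_ ?_
  · obtain ⟨n, f, x, hf, hx⟩ := N.isHolAt_sndMap r hj y
    refine ⟨n, f, x, hf, ?_⟩
    filter_upwards [hx, eventually_rep_fst_ne hi] with q h₁ h₂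
    exact (hval q h₂).trans h₁
  · have hne' : ((rep p.1).2 j)⁻¹ • (Submodule.Quotient.mk (N.sndMap r (rep p.1).2 y) :
        V (r + 1) ⧸ LinearMap.range (N.M (r + 1) (rep p.1))) ≠ 0 := by
      rw [← hθ]
      exact smul_ne_zero (inv_ne_zero hj) ((θ p).map_ne_zero_iff.2 hne)
    exact fun h0 => hne' ((hval p hi).symm.trans h0)

end DNData

end DiscreteNahm

/-! ### The theorem -/

theorem theorem1 (Z : Set ℤ) (hZ : Z.OrdConnected) (k : ℕ)
    (V : ℤ → Type u) [∀ r, AddCommGroup (V r)] [∀ r, Module ℂ (V r)]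
    [∀ r, FiniteDimensional ℂ (V r)] (hk : ∀ r ∈ Z, Module.finrank ℂ (V r) = k)
    (N : DiscreteNahm.DNData V) (hN : N.IsSolutionOn Z) :
    (N.InvertibleOn Z → ∀ r ∈ Z, ∀ r' ∈ Z,
      N.spectralDet r' = N.spectralDet r ∧ N.spectralCurve r' = N.spectralCurve r) ∧
    (∀ r₀ ∈ Z, N.SmoothSpectralCurve r₀ → ∃ S : Set DiscreteNahm.Q,
      (∀ r ∈ Z, N.spectralCurve r = S ∧ N.spectralDet r = N.spectralDet r₀ ∧
        N.SmoothSpectralCurve r) ∧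
      (∀ r ∈ Z, (N.spectralBundle r S).IsHolomorphicLineBundle) ∧
      (∀ r ∈ Z, ∀ r' ∈ Z, (N.spectralBundle r' S).IsIsomorphic
        ((N.spectralBundle r S).tensor
          ((DiscreteNahm.PreBundle.O S 1 (-1)).zpow (r' - r))))) := by
  have hcurve : ∀ r r', N.spectralDet r' = N.spectralDet r →
      N.spectralCurve r' = N.spectralCurve r := by
    intro r r' h
    simp only [DiscreteNahm.DNData.spectralCurve, h]
  constructor
  · intro hinv r hr r' hr'
    have hdet : N.spectralDet r' = N.spectralDet r := by
      refine DiscreteNahm.forall_mem_of_adjacent hZ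
        (P := fun s => N.spectralDet s = N.spectralDet r) (fun s hs hs' => ?_) hr rfl hr'
      obtain ⟨hp, hm⟩ := hinv s hs hs'
      rw [(hN s hs hs').spectralDet_eq_of_bijective hp hm]
    exact ⟨hdet, hcurve r r' hdet⟩
  · intro r₀ hr₀ hsm
    have hV : ∀ s, s ∈ Z → s + 1 ∈ Z →
        Module.finrank ℂ (V s) = Module.finrank ℂ (V (s + 1)) := fun s hs hs' =>
      (hk s hs).trans (hk _ hs').symm
    have hdet : ∀ r ∈ Z, N.spectralDet r = N.spectralDet r₀ := by
      intro r hr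
      refine DiscreteNahm.forall_mem_of_adjacent hZ
        (P := fun s => N.spectralDet s = N.spectralDet r₀) (fun s hs hs' => ?_) hr₀ rfl hr
      constructor
      · intro h
        exact ((hN s hs hs').spectralDet_eq_of_nondegenerate (hV s hs hs')
          (Or.inl (h ▸ hsm.nondegenerate))).symm.trans h
      · intro h
        exact ((hN s hs hs').spectralDet_eq_of_nondegenerate (hV s hs hs')
          (Or.inr (h ▸ hsm.nondegenerate))).trans h
    have hsmooth : ∀ r ∈ Z, N.SmoothSpectralCurve r := by
      intro r hr
      rw [DiscreteNahm.DNData.SmoothSpectralCurve, hdet r hr]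
      exact hsm
    have hS : ∀ r ∈ Z, ∀ q ∈ N.spectralCurve r₀, Module.finrank ℂ
        (V r ⧸ LinearMap.range (N.M r (DiscreteNahm.DNData.rep q))) = 1 := by
      intro r hr q hq
      refine (hsmooth r hr).finrank_quotient q.1.rep_nonzero q.2.rep_nonzero ?_
      rw [hdet r hr]
      exact hq
    have hframes : ∀ r ∈ Z, (N.spectralBundle r (N.spectralCurve r₀)).HasFrames := fun r hr =>
      N.hasFrames_spectralBundle r (hS r hr)
    have hstep : ∀ s t, s ∈ Z → t ∈ Z → t = s + 1 →
        (N.spectralBundle t (N.spectralCurve r₀)).IsIsomorphic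
          ((N.spectralBundle s (N.spectralCurve r₀)).tensor
            (DiscreteNahm.PreBundle.O (N.spectralCurve r₀) 1 (-1))) := by
      rintro s t hs ht rfl
      exact (hN s hs ht).isIsomorphic_succ (hV s hs ht) (hsmooth s hs).nondegenerate
        (hsmooth _ ht).nondegenerate (hS s hs) (hS _ ht)
    refine ⟨N.spectralCurve r₀,
      fun r hr => ⟨hcurve r₀ r (hdet r hr), hdet r hr, hsmooth r hr⟩,
      fun r hr => N.isHolomorphicLineBundle_spectralBundle r (hS r hr), fun r hr r' hr' => ?_⟩
    cases hn : r' - r with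
    | ofNat n =>
      have hn' : r' - r = (n : ℤ) := hn
      have hmem : ∀ m ≤ n, r + (m : ℤ) ∈ Z := fun m hm =>
        hZ.out hr hr' ⟨by omega, by omega⟩
      have := DiscreteNahm.PreBundle.isIsomorphic_tensor_npow
        (DiscreteNahm.PreBundle.hasFrames_O (S := N.spectralCurve r₀))
        (fun m => N.spectralBundle (r + m) (N.spectralCurve r₀)) n
        (fun m hm => hframes _ (hmem m hm)) fun m hm =>
          hstep _ _ (hmem m hm.le) (hmem (m + 1) hm) (by push_cast; ring)
      have e₁ : r + (n : ℤ) = r' := by omega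
      have e₂ : r + ((0 : ℕ) : ℤ) = r := by simp
      simp only [e₁, e₂] at this
      exact this
    | negSucc n =>
      have hn' : r' - r = -((n + 1 : ℕ) : ℤ) := hn
      have hmem : ∀ m ≤ n + 1, r - (m : ℤ) ∈ Z := fun m hm =>
        hZ.out hr' hr ⟨by omega, by omega⟩
      -- Going down from `r`, each step is tensoring with the dual; `negSucc n` stands for `n + 1`
      -- such steps.
      have := DiscreteNahm.PreBundle.isIsomorphic_tensor_npow
        (DiscreteNahm.PreBundle.hasFrames_dual_O (S := N.spectralCurve r₀))
        (fun m => N.spectralBundle (r - m) (N.spectralCurve r₀)) (n + 1)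
        (fun m hm => hframes _ (hmem m hm)) fun m hm =>
          (hstep _ _ (hmem (m + 1) hm) (hmem m hm.le) (by push_cast; ring)).tensor_dual_O
            (hframes _ (hmem (m + 1) hm))
      have e₁ : r - ((n + 1 : ℕ) : ℤ) = r' := by omega
      have e₂ : r - ((0 : ℕ) : ℤ) = r := by simp
      simp only [e₁, e₂] at this
      exact this
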